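/- **Setting.** Let $\mathcal Z,\mathcal V$ be real Hilbert spaces and $\mathcal X$ a real Banach space with continuous embeddings $\mathcal Z\hookrightarrow\mathcal V\hookrightarrow\mathcal X$, the first one being compact and dense; let $T>0$. Let $$\mathcal I(t,z)=\tfrac12\langle Az,z\rangle+\mathcal F(z)-\langle\ell(t),z\rangle,\qquad t\in[0,T],\ z\in\mathcal Z,$$ where $A\in\mathcal L(\mathcal Z,\mathcal Z^*)$ is self-adjoint and coercive ($\langle Az,z\rangle\ge\alpha\|z\|_{\mathcal Z}^2$ with $\alpha>0$), $\ell\in C^{0,1}([0,T];\mathcal V^*)$, and $\mathcal F\in C^2(\mathcal Z;\mathbb R)$, $\mathcal F\ge0$, with $D_z\mathcal F\in C^1(\mathcal Z;\mathcal V^*)$ and $\|D_z^2\mathcal F(z)v\|_{\mathcal V^*}\le C_{\mathcal F}(1+\|z\|_{\mathcal Z}^q)\|v\|_{\mathcal Z}$ for some $q\ge1$. Assume that for every $r>0$ there is $C(r)\ge0$ with $\langle[D_z^2\mathcal I(t,z_1)-D_z^2\mathcal I(t,z_2)]v,v\rangle\le C(r)\|z_1-z_2\|_{\mathcal Z}\|v\|_{\mathcal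 Z}^2$ for all $t\in[0,T]$, all $v\in\mathcal Z$ and all $z_1,z_2\in\mathcal Z$ of norm less than $r$. Let $\mathcal R:\mathcal V\to[0,\infty)$ be lower semicontinuous, convex and positively homogeneous of degree one, with $\underline\rho\|v\|_{\mathcal X}\le\mathcal R(v)\le\overline\rho\|v\|_{\mathcal V}$ for constants $\underline\rho,\overline\rho>0$. Call $z\in\mathcal Z$ *locally stable at time $t$* if $0\in\partial\mathcal R(0)+D_z\mathcal I(t,z)$, and let $z_0\in\mathcal Z$ be locally stable at time $0$. A *differential solution* is a function $z\in W^{1,1}(0,T;\mathcal Z)$ with $z(0)=z_0$ and $0\in\partial\mathcal R(z'(t))+D_z\mathcal I(t,z(t))$ for almost all $t\in[0,T]$. **Scheme.** For $\tau>0$ put $t_0=0$, start with the given $z_0$, and for $k\ge1$ choose $$z_k\in\operatorname{argmin}\{\mathcal I(t_{k-1},z)+\mathcal R(z-z_{k-1}) : z\in\mathcal Z,\ \|z-z_{k-1}\|_{\mathcal V}\le\tau\},\qquad t_k=\min\{t_{k-1}+\tau-\|z_k-z_{k-1}\|_{\mathcal V},\,T\}.$$ Let $N(\tau)$ be the first index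 with $t_{N(\tau)}=T$, let $\hat N(\tau)$ be the first index greater than $N(\tau)$ whose iterate is locally stable at time $T$, and let $\mathfrak k(0)<\mathfrak k(1)<\dots<\mathfrak k(J)$ enumerate the set $\{k\in\{1,\dots,N(\tau)\}: t_k>t_{k-1}\}\cup\{0,\hat N(\tau)\}$. For $1\le j\le J-1$ and $t\in[t_{\mathfrak k(j-1)},t_{\mathfrak k(j)})$ set $$\tilde z_\tau(t)=z_{\mathfrak k(j)}+\frac{t-t_{\mathfrak k(j-1)}}{t_{\mathfrak k(j)}-t_{\mathfrak k(j-1)}}\,\bigl(z_{\mathfrak k(j+1)}-z_{\mathfrak k(j)}\bigr),\qquad \tilde z_\tau(T)=z_{\hat N(\tau)}.$$ **Theorem 3.15.** Assume that $\mathcal I$ is $\kappa$-uniformly convex for some $\kappa>0$, i.e. $\langle D_z^2\mathcal I(t,z)v,v\rangle\ge\kappa\|v\|_{\mathcal Z}^2$ for all $t\in[0,T]$ and $z,v\in\mathcal Z$ (there is no smallness assumption on the Lipschitz constant of $\ell$). Then there is a unique differential solution $z$, and $z\in C^{0,1}([0,T];\mathcal Z)$. For every $\tau>0$ the scheme has iterates,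 and there are constants $C>0$ and $M\in\mathbb N$, independent of $\tau$, such that for every $\tau>0$ and all iterates of the scheme the indices $N(\tau)$ and $\hat N(\tau)$ exist (are finite), stalls last a bounded number of steps, namely $\mathfrak k(j)-\mathfrak k(j-1)\le M$ for $j=1,\dots,J$, and $$\|z(t)-\tilde z_\tau(t)\|_{\mathcal Z}\le C\sqrt\tau\qquad\text{for all } t\in[0,T].$$ -/

import Mathlib

open Set MeasureTheory
open scoped NNReal

noncomputable section

/-- The convex subdifferential of `f : V → ℝ` at `v`, a set of functionals in `V*`. -/
def convexSubdifferential {V : Type*} [NormedAddCommGroup V] [NormedSpace ℝ V]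
    (f : V → ℝ) (v : V) : Set (StrongDual ℝ V) :=
  {ξ | ∀ w : V, f v + ξ (w - v) ≤ f w}

/-- The data of a rate-independent system with semilinear energy. The laws that these data have to
satisfy are collected in `RateIndependentSystem.Assumptions`. -/
structure RateIndependentSystem (Z V X : Type*)
    [NormedAddCommGroup Z] [InnerProductSpace ℝ Z]
    [NormedAddCommGroup V] [InnerProductSpace ℝ V]
    [NormedAddCommGroup X] [NormedSpace ℝ X] where
  /-- the embedding of `Z` into `V` -/
  ι : Z →L[ℝ] V
  /-- the embedding of `V` into `X` -/
  j : V →L[ℝ] X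
  /-- the final time -/
  T : ℝ
  /-- the operator `A : Z → Z*` of the quadratic part of the energy -/
  A : Z →L[ℝ] StrongDual ℝ Z
  /-- the non-quadratic part of the energy -/
  F : Z → ℝ
  /-- the load (only its values on `[0,T]` matter) -/
  ℓ : ℝ → StrongDual ℝ V
  /-- the dissipation potential -/
  R : V → ℝ
  /-- the initial state -/
  z₀ : Z

namespace RateIndependentSystem

variable {Z V X : Type*}
  [NormedAddCommGroup Z] [InnerProductSpace ℝ Z]
  [NormedAddCommGroup V] [InnerProductSpace ℝ V]
  [NormedAddCommGroup X] [NormedSpace ℝ X]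

/-- The energy `I(t,z) = ½⟨Az,z⟩ + F(z) - ⟨ℓ(t),z⟩`. -/
def energy (S : RateIndependentSystem Z V X) (t : ℝ) (z : Z) : ℝ :=
  1 / 2 * S.A z z + S.F z - S.ℓ t (S.ι z)

/-- The derivative `D_z I(t,z) ∈ Z*`. -/
def dEnergy (S : RateIndependentSystem Z V X) (t : ℝ) (z : Z) : StrongDual ℝ Z :=
  fderiv ℝ (S.energy t) z

/-- The second derivative `D_z² I(t,z) : Z → Z*`. -/
def ddEnergy (S : RateIndependentSystem Z V X) (t : ℝ) (z : Z) : Z →L[ℝ] StrongDual ℝ Z :=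
  fderiv ℝ (S.dEnergy t) z

/-- The inclusion `0 ∈ ∂R(v) + D_z I(t,z)` in `Z*`, where functionals on `V` are restricted
to `Z`. -/
def Inclusion (S : RateIndependentSystem Z V X) (v : V) (t : ℝ) (z : Z) : Prop :=
  ∃ ξ ∈ convexSubdifferential S.R v, ξ.comp S.ι + S.dEnergy t z = 0

/-- The state `z` is locally stable at time `t`: `0 ∈ ∂R(0) + D_z I(t,z)`. -/
def LocallyStable (S : RateIndependentSystem Z V X) (t : ℝ) (z : Z) : Prop :=
  S.Inclusion 0 t z

/-- The standing assumptions on the data. -/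
structure Assumptions (S : RateIndependentSystem Z V X) : Prop where
  ι_injective : Function.Injective S.ι
  ι_denseRange : DenseRange S.ι
  ι_compact : IsCompactOperator S.ι
  j_injective : Function.Injective S.j
  T_pos : 0 < S.T
  A_selfAdjoint : ∀ z w : Z, S.A z w = S.A w z
  A_coercive : ∃ α : ℝ, 0 < α ∧ ∀ z : Z, α * ‖z‖ ^ 2 ≤ S.A z z
  ℓ_lipschitz : ∃ L : ℝ≥0, LipschitzOnWith L S.ℓ (Icc 0 S.T)
  F_contDiff : ContDiff ℝ 2 S.F
  F_nonneg : ∀ z : Z, 0 ≤ S.F z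
  /-- `D_z F ∈ C¹(Z;V*)`, with polynomial growth of `D_z² F(z)` as an operator `Z → V*` -/
  F_lowerOrder : ∃ dF : Z → StrongDual ℝ V, ContDiff ℝ 1 dF ∧
    (∀ z v : Z, fderiv ℝ S.F z v = dF z (S.ι v)) ∧
    ∃ q : ℝ, 1 ≤ q ∧ ∃ C : ℝ, ∀ z v : Z, ‖fderiv ℝ dF z v‖ ≤ C * (1 + ‖z‖ ^ q) * ‖v‖
  /-- `I(t,·) ∈ C^{2,1}_loc(Z;ℝ)` -/
  energy_locLipschitz : ∀ r : ℝ, 0 < r → ∃ C : ℝ, 0 ≤ C ∧ ∀ t ∈ Icc 0 S.T,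
    ∀ z₁ ∈ Metric.ball (0 : Z) r, ∀ z₂ ∈ Metric.ball (0 : Z) r, ∀ v : Z,
      (S.ddEnergy t z₁ - S.ddEnergy t z₂) v v ≤ C * ‖z₁ - z₂‖ * ‖v‖ ^ 2
  R_nonneg : ∀ v : V, 0 ≤ S.R v
  R_lowerSemicontinuous : LowerSemicontinuous S.R
  R_convex : ConvexOn ℝ univ S.R
  R_posHomogeneous : ∀ c : ℝ, 0 < c → ∀ v : V, S.R (c • v) = c * S.R v
  R_bounds : ∃ ρ₁ ρ₂ : ℝ, 0 < ρ₁ ∧ 0 < ρ₂ ∧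
    ∀ v : V, ρ₁ * ‖S.j v‖ ≤ S.R v ∧ S.R v ≤ ρ₂ * ‖v‖
  z₀_stable : S.LocallyStable 0 S.z₀

/-- Global `κ`-uniform convexity of the energy for some `κ > 0`. -/
def UniformlyConvex (S : RateIndependentSystem Z V X) : Prop :=
  ∃ κ : ℝ, 0 < κ ∧ ∀ t ∈ Icc 0 S.T, ∀ z v : Z, κ * ‖v‖ ^ 2 ≤ S.ddEnergy t z v v

/-- Differential solutions: `z ∈ W^{1,1}(0,T;Z)`, i.e. (its continuous representative) is the
primitive of an integrable function `g`, which is the derivative `z'`; moreover `z(0) = z₀` and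
`0 ∈ ∂R(z'(t)) + D_z I(t,z(t))` for almost all `t ∈ [0,T]`. -/
def IsDifferentialSolution (S : RateIndependentSystem Z V X) (z : ℝ → Z) : Prop :=
  z 0 = S.z₀ ∧ ∃ g : ℝ → Z, IntervalIntegrable g volume 0 S.T ∧
    (∀ t ∈ Icc 0 S.T, z t = z 0 + ∫ s in (0 : ℝ)..t, g s) ∧
    ∀ᵐ t ∂(volume.restrict (Icc 0 S.T)), S.Inclusion (S.ι (g t)) t (z t)

/-- `(t_k, z_k)` is generated by the local incremental minimization scheme with step size `τ`. The
iteration goes on after the final time has been reached (then `t_k = T`). -/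
structure IsLocalMinScheme (S : RateIndependentSystem Z V X) (τ : ℝ) (t : ℕ → ℝ) (z : ℕ → Z) :
    Prop where
  t_zero : t 0 = 0
  z_zero : z 0 = S.z₀
  feasible : ∀ k, ‖S.ι (z (k + 1) - z k)‖ ≤ τ
  minimal : ∀ k, ∀ w : Z, ‖S.ι (w - z k)‖ ≤ τ →
    S.energy (t k) (z (k + 1)) + S.R (S.ι (z (k + 1) - z k)) ≤
      S.energy (t k) w + S.R (S.ι (w - z k))
  t_succ : ∀ k, t (k + 1) = min (t k + τ - ‖S.ι (z (k + 1) - z k)‖) S.T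

/-- `N(τ)`: the first index with `t_k = T`. -/
def endIndex (S : RateIndependentSystem Z V X) (t : ℕ → ℝ) : ℕ :=
  sInf {k | t k = S.T}

/-- `N̂(τ)`: the first index after `N(τ)` whose iterate is locally stable at time `T`. -/
def stableEndIndex (S : RateIndependentSystem Z V X) (t : ℕ → ℝ) (z : ℕ → Z) : ℕ :=
  sInf {k | S.endIndex t < k ∧ S.LocallyStable S.T (z k)}

/-- The set of the indices `k ∈ {1,…,N(τ)}` with time progress, together with `0` and `N̂(τ)`. -/
def progressIndices (S : RateIndependentSystem Z V X) (t : ℕ → ℝ) (z : ℕ → Z) : Set ℕ :=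
  {k | k ∈ Icc 1 (S.endIndex t) ∧ 0 < t k - t (k - 1)} ∪ {0, S.stableEndIndex t z}

/-- The increasing enumeration `𝔨(0) < 𝔨(1) < …` of `progressIndices`. -/
def progressIndex (S : RateIndependentSystem Z V X) (t : ℕ → ℝ) (z : ℕ → Z) (i : ℕ) : ℕ :=
  Nat.nth (fun k => k ∈ S.progressIndices t z) i

/-- For `s ∈ [0,T)`, the index `i` with `s ∈ [t_{𝔨(i-1)}, t_{𝔨(i)})`. -/
def intervalIndex (S : RateIndependentSystem Z V X) (t : ℕ → ℝ) (z : ℕ → Z) (s : ℝ) : ℕ :=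
  sInf {i | s < t (S.progressIndex t z i)}

/-- The affine interpolant that skips the iterates without time progress: on
`[t_{𝔨(i-1)}, t_{𝔨(i)})` it is
`z_{𝔨(i)} + (s - t_{𝔨(i-1)}) / (t_{𝔨(i)} - t_{𝔨(i-1)}) (z_{𝔨(i+1)} - z_{𝔨(i)})`,
and at `T` it is `z_{N̂(τ)}`. -/
def interpolant (S : RateIndependentSystem Z V X) (t : ℕ → ℝ) (z : ℕ → Z) (s : ℝ) : Z :=
  let 𝔨 := S.progressIndex t z
  let i := S.intervalIndex t z s
  if s < S.T then
    z (𝔨 i) + ((s - t (𝔨 (i - 1))) / (t (𝔨 i) - t (𝔨 (i - 1)))) • (z (𝔨 (i + 1)) - z (𝔨 i))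
  else z (S.stableEndIndex t z)

end RateIndependentSystem

end

/-!
Solutions of the system and interpolants of the scheme are both *approximate solutions*: up to an
error `ε`, their states are stable and their increments over short time intervals satisfy the
dissipation inequality. Let `y` and `w` be approximate solutions, `w` being Lipschitz continuous.
By uniform convexity the Bregman distance `I(y) - I(w) - ⟨D I(w), y - w⟩` controls `‖y - w‖²`. It
does not depend on the load. The first-order part `⟨D I(y) - D I(w), dy - dw⟩` of its increment is
at most of order `ε`: `y` dissipates along `dy`, while the stability of `w` can be tested with `dy`,
and vice versa. The rest is at most `‖y - w‖² ‖dw‖` up to a constant and terms quadratic in the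
increments, so Gronwall's inequality yields `‖y - w‖² = O(ε)`.

The interpolants are approximate solutions with error `O(τ)` and a Lipschitz constant that does not
depend on `τ`. Indeed, the Lagrange multiplier of the constraint `‖z_k - z_{k-1}‖ ≤ τ` measures the
violation of stability. It vanishes after each step with progress in time, which violates stability
by at most `L τ` because the load changes, and every step of a stall lowers this violation by at
least a fixed multiple of `τ`. Hence stalls have bounded length, and the state changes in a stall by
at most a fixed multiple of the time step before it.

The comparison of the interpolants with each other shows that they converge to a solution; with
this solution, it gives the rate `√τ`; with `ε = 0`, it gives uniqueness.
-/

section SymmetricForms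

variable {E : Type*} [NormedAddCommGroup E] [NormedSpace ℝ E]

theorem norm_le_two_mul_of_abs_apply_self_le {H : E →L[ℝ] StrongDual ℝ E}
    (hsymm : ∀ u v, H u v = H v u) {K : ℝ} (hK : 0 ≤ K) (h : ∀ v, |H v v| ≤ K * ‖v‖ ^ 2) :
    ‖H‖ ≤ 2 * K := by
  have polarization (u v : E) : 4 * H u v = H (u + v) (u + v) - H (u - v) (u - v) := by
    simp only [map_add, map_sub, add_apply, sub_apply]
    rw [hsymm v u]
    ring
  have norm_sq_le (w : E) (hw : ‖w‖ ≤ 2) : |H w w| ≤ K * 2 ^ 2 := (h w).trans (by gcongr)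
  refine H.opNorm_le_of_unit_norm (by positivity) fun u hu => ?_
  refine (H u).opNorm_le_of_unit_norm (by positivity) fun v hv => ?_
  have hadd := norm_sq_le (u + v) ((norm_add_le u v).trans (by linarith))
  have hsub := norm_sq_le (u - v) ((norm_sub_le u v).trans (by linarith))
  have hquad := (abs_sub (H (u + v) (u + v)) (H (u - v) (u - v))).trans (add_le_add hadd hsub)
  rw [← polarization, abs_mul, abs_of_pos four_pos] at hquad
  rw [Real.norm_eq_abs]
  linarith

end SymmetricForms

section Bregman

variable {E : Type*} [NormedAddCommGroup E] [NormedSpace ℝ E]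

theorem mul_sq_norm_le_of_le_fderiv {P : E → StrongDual ℝ E} (hP : Differentiable ℝ P) {κ : ℝ}
    (hκ : ∀ z v, κ * ‖v‖ ^ 2 ≤ fderiv ℝ P z v v) (x y : E) :
    κ * ‖x - y‖ ^ 2 ≤ P x (x - y) - P y (x - y) := by
  set v := x - y with hv
  have hderiv (s : ℝ) :
      HasDerivAt (fun s : ℝ => P (y + s • v) v) (fderiv ℝ P (y + s • v) v v) s := by
    have hline : HasDerivAt (fun s : ℝ => y + s • v) v s := by
      simpa using ((hasDerivAt_id s).smul_const v).const_add y
    exact (ContinuousLinearMap.apply ℝ ℝ v).hasFDerivAt.comp_hasDerivAt s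
      ((hP _).hasFDerivAt.comp_hasDerivAt s hline)
  obtain ⟨s, -, hs⟩ := exists_hasDerivAt_eq_slope _ _ zero_lt_one
    (fun s _ => (hderiv s).continuousAt.continuousWithinAt) (fun s _ => hderiv s)
  have hslope := hκ (y + s • v) v
  rw [hs] at hslope
  simpa [hv] using hslope

/-- The Bregman distance of `x` from `y`: the gap at `x` between `f` and its tangent at `y`. -/
noncomputable def bregman (f : E → ℝ) (x y : E) : ℝ :=
  f x - f y - fderiv ℝ f y (x - y)

variable {f : E → ℝ}

theorem bregman_self (x : E) : bregman f x x = 0 := by simp [bregman]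

theorem half_mul_sq_norm_le_bregman (hf : Differentiable ℝ f) {κ : ℝ}
    (hmono : ∀ x y, κ * ‖x - y‖ ^ 2 ≤ fderiv ℝ f x (x - y) - fderiv ℝ f y (x - y)) (x y : E) :
    κ / 2 * ‖x - y‖ ^ 2 ≤ bregman f x y := by
  set v := x - y with hv
  let g : ℝ → ℝ := fun s => f (y + s • v) - s * fderiv ℝ f y v - κ / 2 * s ^ 2 * ‖v‖ ^ 2
  let g' : ℝ → ℝ := fun s => fderiv ℝ f (y + s • v) v - fderiv ℝ f y v - κ * s * ‖v‖ ^ 2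
  have hg (s : ℝ) : HasDerivAt g (g' s) s := by
    have hline : HasDerivAt (fun s : ℝ => y + s • v) v s := by
      simpa using ((hasDerivAt_id s).smul_const v).const_add y
    refine ((((hf _).hasFDerivAt.comp_hasDerivAt s hline).sub
      ((hasDerivAt_id s).mul_const (fderiv ℝ f y v))).sub
      ((((hasDerivAt_id s).pow 2).const_mul (κ / 2)).mul_const (‖v‖ ^ 2))).congr_deriv ?_
    simp only [g', id, one_mul]
    ring
  have hg' {s : ℝ} (hs : 0 < s) : 0 ≤ g' s := by
    have h := hmono (y + s • v) y
    simp only [add_sub_cancel_left, map_smul, smul_eq_mul, norm_smul, Real.norm_eq_abs, mul_pow,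
      sq_abs] at h
    refine nonneg_of_mul_nonneg_right (a := s) ?_ hs
    calc 0 ≤ s * fderiv ℝ f (y + s • v) v - s * fderiv ℝ f y v - κ * (s ^ 2 * ‖v‖ ^ 2) :=
        sub_nonneg.2 h
      _ = s * g' s := by simp only [g']; ring
  have hmono_g : MonotoneOn g (Icc 0 1) := by
    refine monotoneOn_of_deriv_nonneg (convex_Icc 0 1)
      (fun s _ => (hg s).continuousAt.continuousWithinAt)
      (fun s _ => (hg s).differentiableAt.differentiableWithinAt) fun s hs => ?_
    rw [interior_Icc] at hs
    rw [(hg s).deriv]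
    exact hg' hs.1
  have h01 : g 0 ≤ g 1 :=
    hmono_g (left_mem_Icc.2 zero_le_one) (right_mem_Icc.2 zero_le_one) zero_le_one
  have hyx : y + v = x := by rw [hv]; abel
  simp only [g, zero_smul, add_zero, one_smul, hyx] at h01
  simp only [bregman, ← hv]
  linarith

theorem norm_sub_sub_apply_le_of_lipschitz_fderiv {F : Type*} [NormedAddCommGroup F]
    [NormedSpace ℝ F] {P : E → F} (hP : Differentiable ℝ P) {s : Set E} (hs : Convex ℝ s) {M : ℝ}
    (hM : ∀ x ∈ s, ∀ y ∈ s, ‖fderiv ℝ P x - fderiv ℝ P y‖ ≤ M * ‖x - y‖) (hM0 : 0 ≤ M)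
    {p q : E} (hp : p ∈ s) (hq : q ∈ s) :
    ‖P q - P p - fderiv ℝ P p (q - p)‖ ≤ M * ‖q - p‖ ^ 2 := by
  rw [sq, ← mul_assoc]
  refine (convex_segment p q).norm_image_sub_le_of_norm_fderiv_le' (fun z _ => hP z)
    (fun z hz => ?_) (left_mem_segment ℝ p q) (right_mem_segment ℝ p q)
  refine (hM z (hs.segment_subset hp hq hz) p hp).trans ?_
  gcongr
  exact norm_sub_le_of_mem_segment (segment_symm ℝ p q ▸ hz)

/-- The two mixed second differences agree up to third order because `f''(x)` is symmetric. -/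
theorem abs_fderiv_sub_sub_fderiv_sub_le (hf : ContDiff ℝ 2 f) {s : Set E} (hs : Convex ℝ s)
    {M : ℝ} (hM : ∀ x ∈ s, ∀ y ∈ s,
      ‖fderiv ℝ (fderiv ℝ f) x - fderiv ℝ (fderiv ℝ f) y‖ ≤ M * ‖x - y‖) (hM0 : 0 ≤ M)
    {x x' y : E} (hx : x ∈ s) (hx' : x' ∈ s) (hy : y ∈ s) :
    |(fderiv ℝ f x' (y - x) - fderiv ℝ f x (y - x)) -
      (fderiv ℝ f y (x' - x) - fderiv ℝ f x (x' - x))| ≤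
      M * (‖x' - x‖ ^ 2 * ‖y - x‖ + ‖y - x‖ ^ 2 * ‖x' - x‖) := by
  have hf' : Differentiable ℝ (fderiv ℝ f) :=
    (hf.fderiv_right (m := 1) (by norm_num)).differentiable (by norm_num)
  have hsymm : fderiv ℝ (fderiv ℝ f) x (x' - x) (y - x) =
      fderiv ℝ (fderiv ℝ f) x (y - x) (x' - x) :=
    second_derivative_symmetric (fun z => (hf.differentiable (by norm_num) z).hasFDerivAt)
      (hf' x).hasFDerivAt _ _
  have remainder {q : E} (hq : q ∈ s) (w : E) : |fderiv ℝ f q w - fderiv ℝ f x w -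
      fderiv ℝ (fderiv ℝ f) x (q - x) w| ≤ M * ‖q - x‖ ^ 2 * ‖w‖ :=
    (ContinuousLinearMap.le_opNorm _ w).trans <| mul_le_mul_of_nonneg_right
      (norm_sub_sub_apply_le_of_lipschitz_fderiv hf' hs hM hM0 hx hq) (norm_nonneg w)
  have hx'y := abs_le.1 (remainder hx' (y - x))
  have hyx' := abs_le.1 (remainder hy (x' - x))
  rw [hsymm] at hx'y
  rw [abs_le]
  constructor <;> linarith

/-- The first-order part of the increment of the Bregman distance pairs the difference of the two
gradients with the difference of the two increments. -/
theorem bregman_le_add (hf : ContDiff ℝ 2 f) (hnonneg : ∀ x y, 0 ≤ bregman f x y) {s : Set E}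
    (hs : Convex ℝ s) {Λ M : ℝ}
    (hΛ : ∀ x ∈ s, ∀ y ∈ s, ‖fderiv ℝ f x - fderiv ℝ f y‖ ≤ Λ * ‖x - y‖)
    (hM : ∀ x ∈ s, ∀ y ∈ s,
      ‖fderiv ℝ (fderiv ℝ f) x - fderiv ℝ (fderiv ℝ f) y‖ ≤ M * ‖x - y‖) (hM0 : 0 ≤ M)
    {x x' y y' : E} (hx : x ∈ s) (hx' : x' ∈ s) (hy : y ∈ s) (hy' : y' ∈ s) :
    bregman f x' y' ≤ bregman f x y +
      ((fderiv ℝ f x - fderiv ℝ f y) (x' - x) - (fderiv ℝ f x - fderiv ℝ f y) (y' - y)) +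
      Λ * (‖x' - x‖ ^ 2 + ‖x' - x‖ * ‖y' - y‖ + ‖y' - y‖ ^ 2) +
      M * (‖y' - y‖ ^ 2 * ‖x - y‖ + ‖x - y‖ ^ 2 * ‖y' - y‖) := by
  have gradient {p q : E} (hp : p ∈ s) (hq : q ∈ s) (v : E) :
      |fderiv ℝ f q v - fderiv ℝ f p v| ≤ Λ * ‖q - p‖ * ‖v‖ :=
    ((fderiv ℝ f q - fderiv ℝ f p).le_opNorm v).trans
      (mul_le_mul_of_nonneg_right (hΛ q hq p hp) (norm_nonneg v))
  have hxx := (abs_le.1 (gradient hx hx' (x' - x))).2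
  have hyx := (abs_le.1 (gradient hy hy' (x' - x))).1
  have hyy := (abs_le.1 (gradient hy hy' (y' - y))).2
  have hswap := (abs_le.1 (abs_fderiv_sub_sub_fderiv_sub_le hf hs hM hM0 hy hy' hx)).1
  have hconvx := hnonneg x x'
  have hconvy := hnonneg y' y
  have split : x' - y' = (x' - x) - (y' - y) + (x - y) := by abel
  rw [bregman, ← neg_sub x' x, map_neg] at hconvx
  simp only [bregman, split, map_add, map_sub, sub_apply] at hconvy hxx hyx hyy hswap hconvx ⊢
  linarith

end Bregman

section Gronwall

variable {f Γ : ℝ → ℝ} {T c : ℝ}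

theorem le_exp_mul_of_forall_increment_le {δ ε : ℝ} (hc : 0 ≤ c) (hε : 0 ≤ ε) (hδ : 0 < δ)
    (hf : 0 ≤ f 0) (hΓ : MonotoneOn Γ (Icc 0 T))
    (h : ∀ s ∈ Icc 0 T, ∀ t ∈ Icc 0 T, s ≤ t → t - s ≤ δ →
      f t ≤ (1 + c * (t - s)) * f s + ε * (Γ t - Γ s)) {t : ℝ} (ht : t ∈ Icc 0 T) :
    f t ≤ (f 0 + ε * (Γ t - Γ 0)) * Real.exp (c * t) := by
  obtain ⟨n, hn⟩ := exists_nat_ge (t / δ)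
  let x : ℕ → ℝ := fun i => min (i * δ) t
  have hx_zero : x 0 = 0 := by simp [x, ht.1]
  have hx_last : x n = t := min_eq_right ((div_le_iff₀ hδ).1 hn)
  have hx_mem (i : ℕ) : x i ∈ Icc 0 T :=
    ⟨le_min (by positivity) ht.1, (min_le_right _ _).trans ht.2⟩
  have hx_mono (i : ℕ) : x i ≤ x (i + 1) := by
    simp only [x]
    gcongr
    simp
  have hx_step (i : ℕ) : x (i + 1) - x i ≤ δ := by
    rw [sub_le_iff_le_add', ← min_add_add_right]
    refine le_min ((min_le_left _ _).trans_eq ?_) ((min_le_right _ _).trans (by linarith))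
    push_cast
    ring
  have hdiscrete := discrete_gronwall (u := fun i => f (x i)) (c := fun i => c * (x (i + 1) - x i))
    (b := fun i => ε * (Γ (x (i + 1)) - Γ (x i))) (n₀ := 0) (by simpa only [hx_zero] using hf)
    (fun i _ => h _ (hx_mem i) _ (hx_mem _) (hx_mono i) (hx_step i))
    (fun i _ => mul_nonneg hc (sub_nonneg.2 (hx_mono i)))
    (fun i _ => mul_nonneg hε (sub_nonneg.2 (hΓ (hx_mem i) (hx_mem _) (hx_mono i)))) n.zero_le
  simpa only [← Finset.mul_sum, Nat.Ico_zero_eq_range, Finset.sum_range_sub x,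
    Finset.sum_range_sub (fun i => Γ (x i)), hx_zero, hx_last, sub_zero] using hdiscrete

/-- The increments of `f` are only controlled on intervals whose length depends on `η`, so `f` need
not be continuous, and the estimate is the limit `η → 0` of the one on a uniform grid. -/
theorem le_exp_mul_of_small_increment_le {ε : ℝ} (hc : 0 ≤ c) (hε : 0 ≤ ε) (hf : 0 ≤ f 0)
    (hΓ : MonotoneOn Γ (Icc 0 T))
    (h : ∀ η > 0, ∃ δ > 0, ∀ s ∈ Icc 0 T, ∀ t ∈ Icc 0 T, s ≤ t → t - s ≤ δ →
      f t ≤ (1 + c * (t - s)) * f s + (ε + η) * (Γ t - Γ s)) {t : ℝ} (ht : t ∈ Icc 0 T) :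
    f t ≤ (f 0 + ε * (Γ t - Γ 0)) * Real.exp (c * t) := by
  have hlim : Filter.Tendsto (fun η => (f 0 + (ε + η) * (Γ t - Γ 0)) * Real.exp (c * t))
      (nhdsWithin 0 (Ioi 0)) (nhds ((f 0 + (ε + 0) * (Γ t - Γ 0)) * Real.exp (c * t))) :=
    (Continuous.tendsto (by fun_prop) 0).mono_left nhdsWithin_le_nhds
  rw [add_zero] at hlim
  refine ge_of_tendsto hlim (eventually_mem_nhdsWithin.mono fun η hη => ?_)
  obtain ⟨δ, hδ, hstep⟩ := h η hη
  exact le_exp_mul_of_forall_increment_le hc (add_nonneg hε (le_of_lt hη)) hδ hf hΓ hstep ht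

end Gronwall

theorem exists_comp_eq_and_le_of_le_sublinear {E F : Type*} [NormedAddCommGroup E]
    [NormedSpace ℝ E] [NormedAddCommGroup F] [NormedSpace ℝ F] (ι : E →L[ℝ] F) {p : F → ℝ}
    (hsmul : ∀ c : ℝ, 0 < c → ∀ v, p (c • v) = c * p v) (hadd : ∀ v w, p (v + w) ≤ p v + p w)
    {ρ : ℝ} (hρ : ∀ v, p v ≤ ρ * ‖v‖) {φ : StrongDual ℝ E} (hφ : ∀ w, φ w ≤ p (ι w)) :
    ∃ ξ : StrongDual ℝ F, ξ.comp ι = φ ∧ ∀ v, ξ v ≤ p v := by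
  have hker : LinearMap.ker (ι : E →ₗ[ℝ] F) ≤ LinearMap.ker (φ : E →ₗ[ℝ] ℝ) := by
    have hle {w : E} (hw : ι w = 0) : φ w ≤ 0 := by
      simpa [hw] using (hφ w).trans (hρ (ι w))
    intro w (hw : ι w = 0)
    have hneg : φ (-w) ≤ 0 := hle (by rw [map_neg, hw, neg_zero])
    exact le_antisymm (hle hw) (by simpa using hneg)
  let f : F →ₗ.[ℝ] ℝ :=
    { domain := LinearMap.range (ι : E →ₗ[ℝ] F)
      toFun := (LinearMap.ker (ι : E →ₗ[ℝ] F)).liftQ (φ : E →ₗ[ℝ] ℝ) hker ∘ₗ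
        (ι : E →ₗ[ℝ] F).quotKerEquivRange.symm }
  have hf (w : E) : f ⟨ι w, w, rfl⟩ = φ w :=
    congrArg ((LinearMap.ker (ι : E →ₗ[ℝ] F)).liftQ (φ : E →ₗ[ℝ] ℝ) hker)
      ((ι : E →ₗ[ℝ] F).quotKerEquivRange_symm_apply_image w ⟨w, rfl⟩)
  obtain ⟨ξ, hξ, hξp⟩ := exists_extension_of_le_sublinear f p hsmul hadd (by
    rintro ⟨_, w, rfl⟩
    exact (hf w).le.trans (hφ w))
  have hbound (v : F) : ‖ξ v‖ ≤ ρ * ‖v‖ := by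
    have hneg := (hξp (-v)).trans (hρ (-v))
    rw [map_neg, norm_neg] at hneg
    exact abs_le.2 ⟨by linarith, (hξp v).trans (hρ v)⟩
  refine ⟨ξ.mkContinuous ρ hbound, ?_, hξp⟩
  ext w
  exact (hξ ⟨ι w, w, rfl⟩).trans (hf w)

theorem quadratic_error_le {Λ M m ω u v d g k : ℝ} (hΛ : 0 ≤ Λ) (hM : 0 ≤ M) (hm : 0 ≤ m)
    (hu : 0 ≤ u) (hv : 0 ≤ v) (hd : d ≤ m) (hug : u ≤ g) (hvk : v ≤ k) (hg : g ≤ ω)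
    (hk : k ≤ ω) :
    Λ * (u ^ 2 + u * v + v ^ 2) + M * (v ^ 2 * d) ≤ (2 * Λ + m * M) * ω * (g + k) := by
  have hω : 0 ≤ ω := (hu.trans hug).trans hg
  have huω : u ^ 2 ≤ ω * g := by
    rw [sq]
    gcongr
    exact hug.trans hg
  have huv : u * v ≤ ω * k := by
    gcongr
    exact hug.trans hg
  have hvω : v ^ 2 ≤ ω * k := by
    rw [sq]
    gcongr
    exact hvk.trans hk
  have hg0 : 0 ≤ ω * g := (sq_nonneg u).trans huω
  have hvd : v ^ 2 * d ≤ (ω * g + ω * k) * m :=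
    (mul_le_mul_of_nonneg_left hd (sq_nonneg v)).trans (by gcongr; linarith)
  calc Λ * (u ^ 2 + u * v + v ^ 2) + M * (v ^ 2 * d)
      ≤ Λ * (ω * g + ω * k + (ω * g + ω * k)) + M * ((ω * g + ω * k) * m) := by
        gcongr
        linarith
    _ = (2 * Λ + m * M) * ω * (g + k) := by ring

section HilbertValued

open Filter Topology

variable {E : Type*} [NormedAddCommGroup E]

theorem lipschitzOnWith_Icc_of_norm_sub_le {f : ℝ → E} {a b : ℝ} {K : ℝ≥0}
    (h : ∀ s ∈ Icc a b, ∀ t ∈ Icc a b, s ≤ t → ‖f t - f s‖ ≤ K * (t - s)) :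
    LipschitzOnWith K f (Icc a b) := by
  refine LipschitzOnWith.of_dist_le_mul fun s hs t ht => ?_
  rcases le_total s t with hst | hts
  · rw [dist_comm, dist_eq_norm, dist_comm, Real.dist_eq, abs_of_nonneg (sub_nonneg.2 hst)]
    exact h s hs t ht hst
  · rw [dist_eq_norm, Real.dist_eq, abs_of_nonneg (sub_nonneg.2 hts)]
    exact h t ht s hs hts

theorem tendsto_integral_difference_quotient [NormedSpace ℝ E] [CompleteSpace E] {f : ℝ → E}
    (hf : Continuous f) (a b : ℝ) :
    Tendsto (fun h => ∫ u in a..b, h⁻¹ • (f (u + h) - f u)) (𝓝[≠] 0) (𝓝 (f b - f a)) := by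
  have hint (c d : ℝ) : IntervalIntegrable f volume c d := hf.intervalIntegrable c d
  have hshift (h : ℝ) : ∫ u in a..b, h⁻¹ • (f (u + h) - f u) =
      h⁻¹ • (∫ u in b..(b + h), f u) - h⁻¹ • ∫ u in a..(a + h), f u := by
    rw [intervalIntegral.integral_smul, intervalIntegral.integral_sub
      (Continuous.intervalIntegrable (by fun_prop) _ _) (hint _ _),
      intervalIntegral.integral_comp_add_right, ← smul_sub,
      intervalIntegral.integral_interval_sub_interval_comm' (hint _ _) (hint _ _) (hint _ _)]
  have hmean (c : ℝ) : Tendsto (fun h => h⁻¹ • ∫ u in c..(c + h), f u) (𝓝[≠] 0) (𝓝 (f c)) := by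
    have hderiv : HasDerivAt (fun x => ∫ u in c..x, f u) (f c) c :=
      intervalIntegral.integral_hasDerivAt_right (hint _ _)
        (hf.stronglyMeasurableAtFilter _ _) hf.continuousAt
    simpa using hasDerivAt_iff_tendsto_slope_zero.1 hderiv
  simpa only [hshift] using (hmean b).sub (hmean a)

variable [InnerProductSpace ℝ E] [CompleteSpace E]

theorem exists_tendsto_inner_hyperfilter {u : ℕ → E} {B : ℝ} (hu : ∀ n, ‖u n‖ ≤ B) :
    ∃ x : E, ∀ v : E, Tendsto (fun n => inner ℝ (u n) v) (hyperfilter ℕ) (𝓝 (inner ℝ x v)) := by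
  let d : ℕ → WeakDual ℝ E := fun n => StrongDual.toWeakDual (InnerProductSpace.toDual ℝ E (u n))
  obtain ⟨x, -, hx⟩ := (WeakDual.isCompact_closedBall (𝕜 := ℝ) (E := E) 0 B).ultrafilter_le_nhds
    ((hyperfilter ℕ).map d) <| le_principal_iff.2 <| Filter.mem_map.2 <|
      Filter.univ_mem' fun n => by simpa [d] using hu n
  refine ⟨(InnerProductSpace.toDual ℝ E).symm (WeakDual.toStrongDual x), fun v => ?_⟩
  have heval := ((WeakDual.eval_continuous v).tendsto x).comp (show Tendsto d _ _ from hx)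
  simpa [d, Function.comp_def] using heval

theorem exists_tendsto_inner_integral {q : ℕ → ℝ → E} {a b K : ℝ} (hab : a ≤ b)
    (hq : ∀ n, AEStronglyMeasurable (q n)) (hK : ∀ n u, ‖q n u‖ ≤ K) :
    ∃ g : ℝ → E, IntervalIntegrable g volume a b ∧ ∀ t ∈ Icc a b, ∀ v : E,
      Tendsto (fun n => inner ℝ v (∫ s in a..t, q n s)) (hyperfilter ℕ)
        (𝓝 (inner ℝ v (∫ s in a..t, g s))) := by
  set μ : Measure ℝ := volume.restrict (Ioc a b) with hμ
  have hmem (n : ℕ) : MemLp (q n) 2 μ :=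
    MemLp.of_bound (hq n).restrict K (Eventually.of_forall (hK n))
  have hnorm (n : ℕ) : ‖(hmem n).toLp (q n)‖ ≤ _ :=
    Lp.norm_le_of_ae_bound ((norm_nonneg _).trans (hK 0 0)) <| by
      filter_upwards [(hmem n).coeFn_toLp] with u hu
      exact hu ▸ hK n u
  obtain ⟨g, hg⟩ := exists_tendsto_inner_hyperfilter hnorm
  refine ⟨g, (intervalIntegrable_iff_integrableOn_Ioc_of_le hab).2
    ((Lp.memLp g).integrable (by norm_num)), fun t ht v => ?_⟩
  have hrestrict : μ.restrict (Ioc a t) = volume.restrict (Ioc a t) := by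
    rw [hμ, Measure.restrict_restrict measurableSet_Ioc,
      inter_eq_self_of_subset_left (Ioc_subset_Ioc_right ht.2)]
  have hinner (φ : Lp E 2 μ) :
      inner ℝ φ (indicatorConstLp 2 (measurableSet_Ioc (a := a) (b := t)) (measure_ne_top μ _) v) =
        inner ℝ v (∫ s in a..t, φ s) := by
    rw [real_inner_comm, L2.inner_indicatorConstLp_eq_inner_setIntegral, hrestrict,
      intervalIntegral.integral_of_le ht.1]
  have hcongr (n : ℕ) : ∫ s in a..t, (hmem n).toLp (q n) s = ∫ s in a..t, q n s := by
    rw [intervalIntegral.integral_of_le ht.1, intervalIntegral.integral_of_le ht.1, ← hrestrict]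
    exact integral_congr_ae (ae_restrict_of_ae (hmem n).coeFn_toLp)
  simpa only [hinner, hcongr] using
    hg (indicatorConstLp 2 (measurableSet_Ioc (a := a) (b := t)) (measure_ne_top μ _) v)

/-- The derivative is a weak limit of difference quotients. -/
theorem exists_eq_add_integral_of_lipschitzWith {f : ℝ → E} {K : ℝ≥0} (hf : LipschitzWith K f)
    {a b : ℝ} (hab : a ≤ b) :
    ∃ g : ℝ → E, IntervalIntegrable g volume a b ∧
      ∀ t ∈ Icc a b, f t = f a + ∫ s in a..t, g s := by
  have hcont := hf.continuous
  let h : ℕ → ℝ := fun n => 1 / (n + 1)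
  have hpos (n : ℕ) : 0 < h n := by positivity
  have hbound (n : ℕ) (u : ℝ) : ‖(h n)⁻¹ • (f (u + h n) - f u)‖ ≤ K := by
    have hdist := hf.dist_le_mul (u + h n) u
    rw [dist_eq_norm, Real.dist_eq, add_sub_cancel_left, abs_of_pos (hpos n)] at hdist
    rwa [norm_smul, norm_inv, Real.norm_of_nonneg (hpos n).le, inv_mul_le_iff₀ (hpos n),
      mul_comm]
  obtain ⟨g, hg_int, hg⟩ := exists_tendsto_inner_integral hab
    (fun n => (Continuous.aestronglyMeasurable (by fun_prop))) hbound
  refine ⟨g, hg_int, fun t ht => ?_⟩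
  have hh : Tendsto h (hyperfilter ℕ) (𝓝[≠] 0) :=
    (tendsto_nhdsWithin_iff.2 ⟨tendsto_one_div_add_atTop_nhds_zero_nat,
      Eventually.of_forall fun n => (hpos n).ne'⟩).mono_left
        (hyperfilter_le_cofinite.trans Nat.cofinite_eq_atTop.le)
  rw [← sub_eq_iff_eq_add']
  refine ext_inner_left ℝ fun v => tendsto_nhds_unique ?_ (hg t ht v)
  exact tendsto_const_nhds.inner ((tendsto_integral_difference_quotient hcont a t).comp hh)

theorem exists_eq_add_integral_of_lipschitzOnWith {f : ℝ → E} {K : ℝ≥0} {a b : ℝ} (hab : a ≤ b)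
    (hf : LipschitzOnWith K f (Icc a b)) :
    ∃ g : ℝ → E, IntervalIntegrable g volume a b ∧
      ∀ t ∈ Icc a b, f t = f a + ∫ s in a..t, g s := by
  have hext : LipschitzWith K (IccExtend hab ((Icc a b).domRestrict f)) := by
    simpa only [mul_one, IccExtend] using hf.to_restrict.comp (LipschitzWith.projIcc hab)
  obtain ⟨g, hg_int, hg⟩ := exists_eq_add_integral_of_lipschitzWith hext hab
  refine ⟨g, hg_int, fun t ht => ?_⟩
  simpa only [IccExtend_of_mem hab _ ht, IccExtend_left, domRestrict_apply] using hg t ht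

end HilbertValued

theorem nonneg_of_ae_nonneg_of_continuousOn {φ : ℝ → ℝ} {a b : ℝ} (hab : a < b)
    (hφ : ContinuousOn φ (Icc a b)) (h : ∀ᵐ t ∂(volume.restrict (Icc a b)), 0 ≤ φ t) :
    ∀ t ∈ Icc a b, 0 ≤ φ t := fun _ ht =>
  max_eq_left_iff.1 <| Measure.eqOn_Icc_of_ae_eq volume hab.ne
    (h.mono fun _ hs => max_eq_left hs) (hφ.sup continuousOn_const) hφ ht

theorem tendsto_clm_apply {α E F : Type*} [NormedAddCommGroup E] [NormedSpace ℝ E]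
    [NormedAddCommGroup F] [NormedSpace ℝ F] {l : Filter α} {f : α → E →L[ℝ] F} {u : α → E}
    {f₀ : E →L[ℝ] F} {u₀ : E} (hf : Filter.Tendsto f l (nhds f₀))
    (hu : Filter.Tendsto u l (nhds u₀)) :
    Filter.Tendsto (fun a => f a (u a)) l (nhds (f₀ u₀)) :=
  ((continuous_fst.clm_apply continuous_snd).tendsto (f₀, u₀)).comp (hf.prodMk_nhds hu)

section StrongConvexity

variable {E : Type*} [NormedAddCommGroup E] [NormedSpace ℝ E] {f : E → ℝ} {κ : ℝ}

theorem strongConvexOn_of_half_mul_sq_norm_le_bregman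
    (hf : ∀ x y, κ / 2 * ‖x - y‖ ^ 2 ≤ bregman f x y) : StrongConvexOn univ κ f := by
  refine ⟨convex_univ, fun x _ y _ a b ha hb hab => ?_⟩
  obtain rfl : a = 1 - b := eq_sub_of_add_eq hab
  set p := (1 - b) • x + b • y with hp
  have hxp : x - p = b • (x - y) := by rw [hp]; module
  have hyp : y - p = -((1 - b) • (x - y)) := by rw [hp]; module
  have hx := hf x p
  have hy := hf y p
  rw [bregman, hxp, map_smul, norm_smul, Real.norm_of_nonneg hb, smul_eq_mul] at hx
  rw [bregman, hyp, map_neg, map_smul, norm_neg, norm_smul, Real.norm_of_nonneg ha,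
    smul_eq_mul] at hy
  rw [smul_eq_mul, smul_eq_mul]
  linear_combination (1 - b) * hx + b * hy

theorem exists_isMinOn_of_strongConvexOn [CompleteSpace E] {s : Set E} (hκ : 0 < κ)
    (hf : StrongConvexOn s κ f) (hcont : ContinuousOn f s) (hs : IsClosed s) (hne : s.Nonempty)
    (hbdd : BddBelow (f '' s)) : ∃ x ∈ s, IsMinOn f s x := by
  set m := sInf (f '' s)
  have hle (x : E) (hx : x ∈ s) : m ≤ f x := csInf_le hbdd (mem_image_of_mem f hx)
  have hminimizing (n : ℕ) : ∃ x ∈ s, f x < m + 1 / ((n : ℝ) + 1) := by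
    obtain ⟨_, ⟨x, hx, rfl⟩, hlt⟩ := exists_lt_of_csInf_lt (hne.image f)
      (lt_add_of_pos_right m (Nat.one_div_pos_of_nat (α := ℝ) (n := n)))
    exact ⟨x, hx, hlt⟩
  choose x hxs hx using hminimizing
  have hcauchy : CauchySeq x := by
    refine Metric.cauchySeq_iff'.2 fun e he => ?_
    obtain ⟨N, hN⟩ := exists_nat_one_div_lt (show 0 < κ / 8 * e ^ 2 by positivity)
    refine ⟨N, fun n hn => ?_⟩
    have hhalf : (0 : ℝ) ≤ 1 / 2 := by norm_num
    have hmid := hf.2 (hxs n) (hxs N) hhalf hhalf (by norm_num)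
    have hmid_le := hle _ (hf.1 (hxs n) (hxs N) hhalf hhalf (by norm_num))
    have hκ8 : 0 ≤ κ / 8 := by positivity
    have hrate : (1 : ℝ) / ((n : ℝ) + 1) ≤ 1 / ((N : ℝ) + 1) := Nat.one_div_le_one_div hn
    rw [smul_eq_mul, smul_eq_mul] at hmid
    rw [dist_eq_norm]
    refine lt_of_pow_lt_pow_left₀ 2 he.le (lt_of_mul_lt_mul_left ?_ hκ8)
    linarith [hx n, hx N]
  obtain ⟨a, ha⟩ := cauchySeq_tendsto_of_complete hcauchy
  have has : a ∈ s := hs.mem_of_tendsto ha (Filter.Eventually.of_forall hxs)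
  have hfx : Filter.Tendsto (fun n => f (x n)) Filter.atTop (nhds (f a)) :=
    (hcont a has).tendsto.comp (tendsto_nhdsWithin_iff.2 ⟨ha, Filter.Eventually.of_forall hxs⟩)
  have hfa : f a ≤ m := by
    have hbound := (tendsto_one_div_add_atTop_nhds_zero_nat (𝕜 := ℝ)).const_add m
    rw [add_zero] at hbound
    exact le_of_tendsto_of_tendsto' hfx hbound fun n => (hx n).le
  exact ⟨a, has, fun y hy => hfa.trans (hle y hy)⟩

end StrongConvexity

theorem sub_le_fderiv_of_isMinOn_add {E : Type*} [NormedAddCommGroup E] [NormedSpace ℝ E]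
    {f g : E → ℝ} {s : Set E} {x y : E} (hf : DifferentiableAt ℝ f x) (hg : ConvexOn ℝ s g)
    (hmin : IsMinOn (fun w => f w + g w) s x) (hx : x ∈ s) (hy : y ∈ s) :
    g x - g y ≤ fderiv ℝ f x (y - x) := by
  refine ge_of_tendsto (hf.hasFDerivAt.hasLineDerivAt (y - x)).tendsto_slope_zero_right ?_
  filter_upwards [Ioo_mem_nhdsGT one_pos] with r hr
  have hseg : x + r • (y - x) = (1 - r) • x + r • y := by module
  have hconv := hg.2 hx hy (sub_nonneg.2 hr.2.le) hr.1.le (sub_add_cancel 1 r)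
  have hle : f x + g x ≤ f (x + r • (y - x)) + g (x + r • (y - x)) :=
    hmin (hg.1.add_smul_sub_mem hx hy ⟨hr.1.le, hr.2.le⟩)
  rw [← hseg, smul_eq_mul, smul_eq_mul] at hconv
  rw [smul_eq_mul, le_inv_mul_iff₀ hr.1]
  linarith

theorem exists_mem_Icc_succ {α : Type*} [LinearOrder α] {σ : ℕ → α} {m : ℕ} (hm : m ≠ 0) {t : α}
    (ht : t ∈ Icc (σ 0) (σ m)) : ∃ i < m, t ∈ Icc (σ i) (σ (i + 1)) := by
  induction m with
  | zero => exact absurd rfl hm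
  | succ m ih =>
    rcases le_total (σ m) t with hmt | htm
    · exact ⟨m, m.lt_succ_self, hmt, ht.2⟩
    · rcases eq_or_ne m 0 with rfl | hm
      · exact ⟨0, one_pos, ht⟩
      · obtain ⟨i, hi, hti⟩ := ih hm ⟨ht.1, htm⟩
        exact ⟨i, hi.trans m.lt_succ_self, hti⟩

theorem rel_of_rel_on_Icc_succ {α : Type*} [LinearOrder α] {σ : ℕ → α} {m : ℕ} (hm : m ≠ 0)
    (hσ : MonotoneOn σ (Iic m)) {r : α → α → Prop}
    (htrans : ∀ s u t, s ≤ u → u ≤ t → r s u → r u t → r s t)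
    (hpiece : ∀ i < m, ∀ s ∈ Icc (σ i) (σ (i + 1)), ∀ t ∈ Icc (σ i) (σ (i + 1)), s ≤ t → r s t)
    {s t : α} (hs : s ∈ Icc (σ 0) (σ m)) (ht : t ∈ Icc (σ 0) (σ m)) (hst : s ≤ t) : r s t := by
  obtain ⟨i, hi, hsi⟩ := exists_mem_Icc_succ hm hs
  have hextend (n : ℕ) (hn : i + 1 ≤ n) : n ≤ m → ∀ t, s ≤ t → t ≤ σ n → r s t := by
    induction n, hn using Nat.le_induction with
    | base => exact fun _ t hst ht => hpiece i hi s hsi t ⟨hsi.1.trans hst, ht⟩ hst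
    | succ n hn ih =>
      intro hnm t hst ht
      have hsn : s ≤ σ n := hsi.2.trans (hσ hi (n.le_succ.trans hnm) hn)
      rcases le_total t (σ n) with htn | htn
      · exact ih (n.le_succ.trans hnm) t hst htn
      · exact htrans s (σ n) t hsn htn (ih (n.le_succ.trans hnm) _ hsn le_rfl)
          (hpiece n hnm _ ⟨le_rfl, htn.trans ht⟩ t ⟨htn, ht⟩ htn)
  exact hextend m hi le_rfl t hst ht.2

section Interpolation

variable {E : Type*} [NormedAddCommGroup E] [NormedSpace ℝ E] {m i : ℕ} {σ : ℕ → ℝ} {w : ℕ → E}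
  {y : ℝ → E} {s t : ℝ}

/-- The function `y` interpolates the values `w 0, …, w m` at the nodes `σ 0, …, σ m` affinely. -/
def IsAffineInterpolant (m : ℕ) (σ : ℕ → ℝ) (w : ℕ → E) (y : ℝ → E) : Prop :=
  ∀ i < m, ∀ t ∈ Icc (σ i) (σ (i + 1)),
    y t = w i + ((t - σ i) / (σ (i + 1) - σ i)) • (w (i + 1) - w i)

namespace IsAffineInterpolant

theorem apply_node (hy : IsAffineInterpolant m σ w y) (hi : i < m) (hσ : σ i ≤ σ (i + 1)) :
    y (σ i) = w i := by
  rw [hy i hi _ (left_mem_Icc.2 hσ), sub_self, zero_div, zero_smul, add_zero]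

theorem apply_node_succ (hy : IsAffineInterpolant m σ w y) (hi : i < m) (hσ : σ i < σ (i + 1)) :
    y (σ (i + 1)) = w (i + 1) := by
  rw [hy i hi _ (right_mem_Icc.2 hσ.le), div_self (sub_pos.2 hσ).ne', one_smul,
    add_sub_cancel]

theorem sub_eq (hy : IsAffineInterpolant m σ w y) (hi : i < m) (hs : s ∈ Icc (σ i) (σ (i + 1)))
    (ht : t ∈ Icc (σ i) (σ (i + 1))) :
    y t - y s = ((t - s) / (σ (i + 1) - σ i)) • (w (i + 1) - w i) := by
  rw [hy i hi t ht, hy i hi s hs, add_sub_add_left_eq_sub, ← sub_smul, ← sub_div,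
    sub_sub_sub_cancel_right]

theorem norm_le (hy : IsAffineInterpolant m σ w y) (hm : m ≠ 0) {b : ℝ}
    (hw : ∀ i ≤ m, ‖w i‖ ≤ b) (ht : t ∈ Icc (σ 0) (σ m)) : ‖y t‖ ≤ b := by
  obtain ⟨i, hi, hti⟩ := exists_mem_Icc_succ hm ht
  have hpiece := sub_nonneg.2 (hti.1.trans hti.2)
  rw [hy i hi t hti, ← mem_closedBall_zero_iff]
  exact (convex_closedBall (0 : E) b).add_smul_sub_mem
    (mem_closedBall_zero_iff.2 (hw i hi.le)) (mem_closedBall_zero_iff.2 (hw (i + 1) hi))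
    ⟨div_nonneg (sub_nonneg.2 hti.1) hpiece,
      div_le_one_of_le₀ (sub_le_sub_right hti.2 _) hpiece⟩

theorem norm_sub_le (hy : IsAffineInterpolant m σ w y) (hm : m ≠ 0)
    (hσ : StrictMonoOn σ (Iic m)) {K : ℝ}
    (hw : ∀ i < m, ‖w (i + 1) - w i‖ ≤ K * (σ (i + 1) - σ i)) (hs : s ∈ Icc (σ 0) (σ m))
    (ht : t ∈ Icc (σ 0) (σ m)) (hst : s ≤ t) : ‖y t - y s‖ ≤ K * (t - s) := by
  refine rel_of_rel_on_Icc_succ (r := fun s t => ‖y t - y s‖ ≤ K * (t - s)) hm hσ.monotoneOn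
    (fun s u t _ _ hsu hut => ?_) (fun i hi s hs t ht hst => ?_) hs ht hst
  · linarith [norm_sub_le_norm_sub_add_norm_sub (y t) (y u) (y s)]
  · have hpiece : 0 < σ (i + 1) - σ i := sub_pos.2 (hσ hi.le hi i.lt_succ_self)
    have hts := sub_nonneg.2 hst
    rw [hy.sub_eq hi hs ht, norm_smul, Real.norm_of_nonneg (div_nonneg hts hpiece.le)]
    calc (t - s) / (σ (i + 1) - σ i) * ‖w (i + 1) - w i‖
        ≤ (t - s) / (σ (i + 1) - σ i) * (K * (σ (i + 1) - σ i)) := by gcongr; exact hw i hi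
      _ = K * (t - s) := by field_simp

end IsAffineInterpolant

end Interpolation

namespace RateIndependentSystem

variable {Z V X : Type*}
  [NormedAddCommGroup Z] [InnerProductSpace ℝ Z]
  [NormedAddCommGroup V] [InnerProductSpace ℝ V]
  [NormedAddCommGroup X] [NormedSpace ℝ X]
  {S : RateIndependentSystem Z V X} {κ : ℝ} {L ρ : ℝ≥0}

/-- The assumptions under which the scheme is shown to converge: uniform convexity of the energy
with constant `κ`, a load with Lipschitz constant `L`, and a sublinear dissipation potential with
`R v ≤ ρ ‖v‖`. The second derivative of the energy does not depend on time, so the conditions on it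
are imposed at time `0` only. -/
structure ConvexAssumptions (S : RateIndependentSystem Z V X) (κ : ℝ) (L ρ : ℝ≥0) : Prop where
  T_pos : 0 < S.T
  ℓ_lipschitz : LipschitzOnWith L S.ℓ (Icc 0 S.T)
  F_contDiff : ContDiff ℝ 2 S.F
  κ_pos : 0 < κ
  convex : ∀ z v : Z, κ * ‖v‖ ^ 2 ≤ S.ddEnergy 0 z v v
  energy_locLipschitz : ∀ r : ℝ, 0 < r → ∃ C : ℝ, 0 ≤ C ∧
    ∀ z₁ ∈ Metric.ball (0 : Z) r, ∀ z₂ ∈ Metric.ball (0 : Z) r, ∀ v : Z,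
      (S.ddEnergy 0 z₁ - S.ddEnergy 0 z₂) v v ≤ C * ‖z₁ - z₂‖ * ‖v‖ ^ 2
  R_nonneg : ∀ v : V, 0 ≤ S.R v
  R_convex : ConvexOn ℝ univ S.R
  R_posHomogeneous : ∀ c : ℝ, 0 < c → ∀ v : V, S.R (c • v) = c * S.R v
  R_le : ∀ v : V, S.R v ≤ ρ * ‖v‖
  z₀_stable : S.LocallyStable 0 S.z₀

theorem Assumptions.exists_convexAssumptions {S : RateIndependentSystem Z V X}
    (hS : S.Assumptions) (hconv : S.UniformlyConvex) :
    ∃ (κ : ℝ) (L ρ : ℝ≥0), S.ConvexAssumptions κ L ρ := by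
  obtain ⟨κ, hκ, hconv⟩ := hconv
  obtain ⟨L, hL⟩ := hS.ℓ_lipschitz
  obtain ⟨_, ρ, -, hρ, hR⟩ := hS.R_bounds
  have h0 : (0 : ℝ) ∈ Icc 0 S.T := left_mem_Icc.2 hS.T_pos.le
  exact ⟨κ, L, ⟨ρ, hρ.le⟩,
    { T_pos := hS.T_pos
      ℓ_lipschitz := hL
      F_contDiff := hS.F_contDiff
      κ_pos := hκ
      convex := hconv 0 h0
      energy_locLipschitz := fun r hr =>
        (hS.energy_locLipschitz r hr).imp fun _ hC => ⟨hC.1, hC.2 0 h0⟩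
      R_nonneg := hS.R_nonneg
      R_convex := hS.R_convex
      R_posHomogeneous := hS.R_posHomogeneous
      R_le := fun v => (hR v).2
      z₀_stable := hS.z₀_stable }⟩

/-- The dissipation potential `R` restricted to `Z`. -/
def diss (S : RateIndependentSystem Z V X) (w : Z) : ℝ :=
  S.R (S.ι w)

/-- Local stability at time `t` up to an error `e`, tested with elements of `Z`. -/
def AlmostStable (S : RateIndependentSystem Z V X) (e t : ℝ) (z : Z) : Prop :=
  ∀ w : Z, 0 ≤ S.dEnergy t z w + S.diss w + e * ‖w‖

/-- An a priori bound for the norm of the states of solutions and of iterates of the scheme. -/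
noncomputable def stateBound (S : RateIndependentSystem Z V X) (κ : ℝ) (L ρ : ℝ≥0) : ℝ :=
  (ρ * ‖S.ι‖ + 2 * (L * S.T * ‖S.ι‖) + ‖S.dEnergy 0 0‖) / κ

namespace ConvexAssumptions

theorem R_zero (hS : S.ConvexAssumptions κ L ρ) : S.R 0 = 0 :=
  le_antisymm (by simpa using hS.R_le 0) (hS.R_nonneg 0)

theorem R_add_le (hS : S.ConvexAssumptions κ L ρ) (v w : V) : S.R (v + w) ≤ S.R v + S.R w := by
  have hmid := hS.R_convex.2 (mem_univ v) (mem_univ w) one_half_pos.le one_half_pos.le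
    (add_halves (1 : ℝ))
  rw [← smul_add, hS.R_posHomogeneous _ one_half_pos] at hmid
  simp only [smul_eq_mul] at hmid
  linarith

theorem diss_nonneg (hS : S.ConvexAssumptions κ L ρ) (w : Z) : 0 ≤ S.diss w :=
  hS.R_nonneg _

theorem diss_zero (hS : S.ConvexAssumptions κ L ρ) : S.diss 0 = 0 := by
  rw [diss, map_zero, hS.R_zero]

theorem diss_add_le (hS : S.ConvexAssumptions κ L ρ) (v w : Z) :
    S.diss (v + w) ≤ S.diss v + S.diss w := by
  simpa only [diss, map_add] using hS.R_add_le (S.ι v) (S.ι w)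

theorem diss_smul (hS : S.ConvexAssumptions κ L ρ) {a : ℝ} (ha : 0 ≤ a) (w : Z) :
    S.diss (a • w) = a * S.diss w := by
  rcases ha.eq_or_lt with rfl | ha
  · rw [zero_smul, zero_mul, hS.diss_zero]
  · rw [diss, map_smul, hS.R_posHomogeneous a ha, diss]

theorem diss_le_norm (hS : S.ConvexAssumptions κ L ρ) (w : Z) :
    S.diss w ≤ ρ * ‖S.ι‖ * ‖w‖ := by
  rw [mul_assoc]
  exact (hS.R_le _).trans (mul_le_mul_of_nonneg_left (S.ι.le_opNorm w) ρ.2)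

theorem contDiff_energy (hS : S.ConvexAssumptions κ L ρ) (t : ℝ) : ContDiff ℝ 2 (S.energy t) :=
  ((contDiff_const.mul (S.A.contDiff.clm_apply contDiff_id)).add hS.F_contDiff).sub
    ((S.ℓ t).contDiff.comp S.ι.contDiff)

theorem differentiable_energy (hS : S.ConvexAssumptions κ L ρ) (t : ℝ) :
    Differentiable ℝ (S.energy t) :=
  (hS.contDiff_energy t).differentiable (by norm_num)

theorem differentiable_dEnergy (hS : S.ConvexAssumptions κ L ρ) (t : ℝ) :
    Differentiable ℝ (S.dEnergy t) :=
  ((hS.contDiff_energy t).fderiv_right (m := 1) (by norm_num)).differentiable (by norm_num)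

theorem continuous_dEnergy (hS : S.ConvexAssumptions κ L ρ) (t : ℝ) : Continuous (S.dEnergy t) :=
  (hS.differentiable_dEnergy t).continuous

theorem dEnergy_apply (hS : S.ConvexAssumptions κ L ρ) (s t : ℝ) (z w : Z) :
    S.dEnergy t z w = S.dEnergy s z w - (S.ℓ t - S.ℓ s) (S.ι w) := by
  have henergy : S.energy t = S.energy s - ⇑((S.ℓ t - S.ℓ s).comp S.ι) := by
    funext z
    simp only [energy, Pi.sub_apply, ContinuousLinearMap.comp_apply, sub_apply]
    ring
  have hderiv : S.dEnergy t z = S.dEnergy s z - (S.ℓ t - S.ℓ s).comp S.ι := by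
    rw [dEnergy, henergy, fderiv_sub (hS.differentiable_energy s z)
      (ContinuousLinearMap.differentiableAt _), ContinuousLinearMap.fderiv, dEnergy]
  rw [hderiv]
  rfl

theorem dEnergy_sub_dEnergy_apply (hS : S.ConvexAssumptions κ L ρ) (s t : ℝ) (x y w : Z) :
    S.dEnergy s x w - S.dEnergy s y w = S.dEnergy t x w - S.dEnergy t y w := by
  rw [hS.dEnergy_apply t s x, hS.dEnergy_apply t s y]
  ring

theorem abs_load_sub_le (hS : S.ConvexAssumptions κ L ρ) {s t : ℝ} (hs : s ∈ Icc 0 S.T)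
    (ht : t ∈ Icc 0 S.T) (w : Z) : |(S.ℓ t - S.ℓ s) (S.ι w)| ≤ L * |t - s| * ‖S.ι w‖ := by
  refine ((S.ℓ t - S.ℓ s).le_opNorm _).trans ?_
  gcongr
  simpa only [dist_eq_norm, Real.norm_eq_abs] using hS.ℓ_lipschitz.dist_le_mul t ht s hs

theorem abs_load_sub_le_norm (hS : S.ConvexAssumptions κ L ρ) {s t : ℝ} (hs : s ∈ Icc 0 S.T)
    (ht : t ∈ Icc 0 S.T) (w : Z) : |(S.ℓ t - S.ℓ s) (S.ι w)| ≤ L * ‖S.ι‖ * |t - s| * ‖w‖ :=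
  calc |(S.ℓ t - S.ℓ s) (S.ι w)| ≤ L * |t - s| * ‖S.ι w‖ := hS.abs_load_sub_le hs ht w
    _ ≤ L * |t - s| * (‖S.ι‖ * ‖w‖) := by gcongr; exact S.ι.le_opNorm w
    _ = L * ‖S.ι‖ * |t - s| * ‖w‖ := by ring

theorem dEnergy_strongly_monotone (hS : S.ConvexAssumptions κ L ρ) (t : ℝ) (x y : Z) :
    κ * ‖x - y‖ ^ 2 ≤ S.dEnergy t x (x - y) - S.dEnergy t y (x - y) := by
  rw [hS.dEnergy_sub_dEnergy_apply t 0]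
  exact mul_sq_norm_le_of_le_fderiv (hS.differentiable_dEnergy 0) hS.convex x y

theorem half_mul_sq_norm_le_bregman_energy (hS : S.ConvexAssumptions κ L ρ) (t : ℝ) (x y : Z) :
    κ / 2 * ‖x - y‖ ^ 2 ≤ bregman (S.energy t) x y :=
  half_mul_sq_norm_le_bregman (hS.differentiable_energy t) (hS.dEnergy_strongly_monotone t) x y

theorem sq_norm_le_bregman_energy (hS : S.ConvexAssumptions κ L ρ) (t : ℝ) (x y : Z) :
    ‖x - y‖ ^ 2 ≤ 2 / κ * bregman (S.energy t) x y := by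
  rw [div_mul_eq_mul_div, le_div_iff₀ hS.κ_pos]
  linarith [hS.half_mul_sq_norm_le_bregman_energy t x y]

theorem bregman_energy_nonneg (hS : S.ConvexAssumptions κ L ρ) (t : ℝ) (x y : Z) :
    0 ≤ bregman (S.energy t) x y :=
  nonneg_of_mul_nonneg_right ((sq_nonneg _).trans (hS.sq_norm_le_bregman_energy t x y))
    (div_pos two_pos hS.κ_pos)

theorem exists_ddEnergy_lipschitz (hS : S.ConvexAssumptions κ L ρ) (b : ℝ) :
    ∃ M : ℝ, 0 ≤ M ∧ ∀ x ∈ Metric.closedBall (0 : Z) b, ∀ y ∈ Metric.closedBall (0 : Z) b,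
      ‖S.ddEnergy 0 x - S.ddEnergy 0 y‖ ≤ M * ‖x - y‖ := by
  obtain ⟨C, hC, hlip⟩ := hS.energy_locLipschitz (|b| + 1) (by positivity)
  have hball : Metric.closedBall (0 : Z) b ⊆ Metric.ball 0 (|b| + 1) :=
    Metric.closedBall_subset_ball (by linarith [le_abs_self b])
  have hsymm (x u v : Z) : S.ddEnergy 0 x u v = S.ddEnergy 0 x v u :=
    second_derivative_symmetric (fun z => (hS.differentiable_energy 0 z).hasFDerivAt)
      (hS.differentiable_dEnergy 0 x).hasFDerivAt u v
  refine ⟨2 * C, by positivity, fun x hx y hy => ?_⟩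
  rw [mul_assoc]
  refine norm_le_two_mul_of_abs_apply_self_le (fun u v => ?_) (by positivity) fun v => ?_
  · simp only [sub_apply, hsymm _ u v]
  · have hxy := hlip x (hball hx) y (hball hy) v
    have hyx := hlip y (hball hy) x (hball hx) v
    rw [norm_sub_rev y x, ← neg_sub (S.ddEnergy 0 x), neg_apply, neg_apply] at hyx
    exact abs_le.2 ⟨by linarith, hxy⟩

theorem exists_dEnergy_lipschitzOnWith (hS : S.ConvexAssumptions κ L ρ) (b : ℝ) :
    ∃ Λ : ℝ≥0, LipschitzOnWith Λ (S.dEnergy 0) (Metric.closedBall 0 b) := by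
  obtain ⟨M, hM, hlip⟩ := hS.exists_ddEnergy_lipschitz b
  refine ⟨⟨‖S.ddEnergy 0 0‖ + M * |b|, by positivity⟩,
    (convex_closedBall (0 : Z) b).lipschitzOnWith_of_nnnorm_fderiv_le
      (fun z _ => hS.differentiable_dEnergy 0 z) fun z hz => ?_⟩
  have h0 : (0 : Z) ∈ Metric.closedBall (0 : Z) b :=
    Metric.mem_closedBall_self (Metric.nonneg_of_mem_closedBall hz)
  change ‖S.ddEnergy 0 z‖ ≤ ‖S.ddEnergy 0 0‖ + M * |b|
  calc ‖S.ddEnergy 0 z‖ ≤ ‖S.ddEnergy 0 0‖ + ‖S.ddEnergy 0 z - S.ddEnergy 0 0‖ :=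
        sub_le_iff_le_add'.1 (norm_sub_norm_le (S.ddEnergy 0 z) (S.ddEnergy 0 0))
    _ ≤ ‖S.ddEnergy 0 0‖ + M * ‖z - 0‖ := by gcongr; exact hlip z hz 0 h0
    _ ≤ ‖S.ddEnergy 0 0‖ + M * |b| := by
        gcongr
        rw [sub_zero]
        exact (mem_closedBall_zero_iff.1 hz).trans (le_abs_self b)

theorem abs_dEnergy_sub_apply_le (hS : S.ConvexAssumptions κ L ρ) {Λ : ℝ≥0} {b s t : ℝ} {x y : Z}
    (hΛ : LipschitzOnWith Λ (S.dEnergy 0) (Metric.closedBall 0 b)) (hs : s ∈ Icc 0 S.T)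
    (ht : t ∈ Icc 0 S.T) (hx : ‖x‖ ≤ b) (hy : ‖y‖ ≤ b) (w : Z) :
    |S.dEnergy s x w - S.dEnergy t y w| ≤
      (Λ * ‖x - y‖ + L * ‖S.ι‖ * |s - t|) * ‖w‖ := by
  have hstate : |(S.dEnergy 0 x - S.dEnergy 0 y) w| ≤ Λ * ‖x - y‖ * ‖w‖ := by
    refine ((S.dEnergy 0 x - S.dEnergy 0 y).le_opNorm w).trans ?_
    gcongr
    simpa only [dist_eq_norm] using
      hΛ.dist_le_mul x (mem_closedBall_zero_iff.2 hx) y (mem_closedBall_zero_iff.2 hy)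
  have hsplit : S.dEnergy s x w - S.dEnergy t y w =
      (S.dEnergy 0 x - S.dEnergy 0 y) w - (S.ℓ s - S.ℓ t) (S.ι w) := by
    rw [sub_apply, hS.dEnergy_sub_dEnergy_apply 0 t, hS.dEnergy_apply t s]
    ring
  rw [hsplit, add_mul]
  exact (abs_sub _ _).trans (add_le_add hstate (hS.abs_load_sub_le_norm ht hs w))

theorem inclusion_iff (hS : S.ConvexAssumptions κ L ρ) {t : ℝ} {v z : Z} :
    S.Inclusion (S.ι v) t z ↔ S.AlmostStable 0 t z ∧ S.dEnergy t z v + S.diss v ≤ 0 := by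
  simp only [AlmostStable, zero_mul, add_zero]
  constructor
  · rintro ⟨ξ, hξ, hforce⟩
    have hforce (w : Z) : S.dEnergy t z w = -ξ (S.ι w) :=
      eq_neg_of_add_eq_zero_right (DFunLike.congr_fun hforce w)
    refine ⟨fun w => ?_, ?_⟩
    · have hsub := hξ (S.ι v + S.ι w)
      rw [add_sub_cancel_left] at hsub
      rw [hforce w, diss]
      linarith [hS.R_add_le (S.ι v) (S.ι w)]
    · have hsub := hξ 0
      rw [hS.R_zero, zero_sub, map_neg] at hsub
      rw [hforce v, diss]
      linarith
  · rintro ⟨hstable, hdiss⟩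
    obtain ⟨ξ, hξ, hξR⟩ := exists_comp_eq_and_le_of_le_sublinear S.ι hS.R_posHomogeneous
      hS.R_add_le hS.R_le (φ := -S.dEnergy t z) fun w => by
        rw [neg_apply, ← diss]
        linarith [hstable w]
    refine ⟨ξ, fun w => ?_, by rw [hξ, neg_add_cancel]⟩
    have hv : ξ (S.ι v) = -S.dEnergy t z v := DFunLike.congr_fun hξ v
    rw [diss] at hdiss
    rw [map_sub, hv]
    linarith [hξR w]

theorem locallyStable_iff (hS : S.ConvexAssumptions κ L ρ) {t : ℝ} {z : Z} :
    S.LocallyStable t z ↔ S.AlmostStable 0 t z := by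
  rw [LocallyStable, ← map_zero S.ι, hS.inclusion_iff, map_zero, hS.diss_zero, add_zero]
  exact and_iff_left le_rfl

theorem stateBound_nonneg (hS : S.ConvexAssumptions κ L ρ) : 0 ≤ S.stateBound κ L ρ := by
  have := hS.κ_pos
  have := hS.T_pos
  rw [stateBound]
  positivity

theorem norm_le_stateBound (hS : S.ConvexAssumptions κ L ρ) {e t : ℝ} {z : Z}
    (ht : t ∈ Icc 0 S.T) (he : e ≤ L * S.T * ‖S.ι‖) (hz : S.AlmostStable e t z) :
    ‖z‖ ≤ S.stateBound κ L ρ := by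
  rcases (norm_nonneg z).eq_or_lt with hz0 | hz0
  · exact hz0 ▸ hS.stateBound_nonneg
  have htest := hz (-z)
  rw [map_neg, norm_neg] at htest
  have hdiss := hS.diss_le_norm (-z)
  rw [norm_neg] at hdiss
  have hmono := hS.dEnergy_strongly_monotone t z 0
  rw [sub_zero, hS.dEnergy_apply 0 t 0] at hmono
  have hload := (abs_le.1 (hS.abs_load_sub_le_norm (left_mem_Icc.2 hS.T_pos.le) ht z)).2
  have hstart := (abs_le.1 ((S.dEnergy 0 0).le_opNorm z)).1
  have htime : L * ‖S.ι‖ * |t - 0| * ‖z‖ ≤ L * S.T * ‖S.ι‖ * ‖z‖ := by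
    rw [sub_zero, abs_of_nonneg ht.1, mul_right_comm (L : ℝ)]
    gcongr
    exact ht.2
  have herr : e * ‖z‖ ≤ L * S.T * ‖S.ι‖ * ‖z‖ := by gcongr
  rw [stateBound, le_div_iff₀ hS.κ_pos]
  refine le_of_mul_le_mul_right ?_ hz0
  linarith

end ConvexAssumptions

/-! ### Comparison of approximate solutions -/

/-- Solutions up to an error `ε` with states bounded by `b`, described without derivatives: the
increments of `y` are dominated by those of the continuous function `G`, the states are stable up
to `ε`, and over short time intervals the increments satisfy the energy balance up to `ε` times the
increment of `G`. -/
structure IsApproxSolution (S : RateIndependentSystem Z V X) (ε b : ℝ) (G : ℝ → ℝ) (y : ℝ → Z) :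
    Prop where
  initial : y 0 = S.z₀
  norm_le : ∀ t ∈ Icc 0 S.T, ‖y t‖ ≤ b
  continuousOn : ContinuousOn G (Icc 0 S.T)
  norm_sub_le : ∀ s ∈ Icc 0 S.T, ∀ t ∈ Icc 0 S.T, s ≤ t → ‖y t - y s‖ ≤ G t - G s
  stable : ∀ t ∈ Icc 0 S.T, S.AlmostStable ε t (y t)
  dissipation : ∀ η > 0, ∃ δ > 0, ∀ s ∈ Icc 0 S.T, ∀ t ∈ Icc 0 S.T, s ≤ t → t - s ≤ δ →
    S.dEnergy s (y s) (y t - y s) + S.diss (y t - y s) ≤ (ε + η) * (G t - G s)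

namespace IsApproxSolution

variable {ε b : ℝ} {G : ℝ → ℝ} {y : ℝ → Z}

theorem monotoneOn (hy : S.IsApproxSolution ε b G y) : MonotoneOn G (Icc 0 S.T) :=
  fun s hs t ht hst => sub_nonneg.1 ((norm_nonneg _).trans (hy.norm_sub_le s hs t ht hst))

theorem exists_small_increments (hy : S.IsApproxSolution ε b G y) {η ω : ℝ} (hη : 0 < η)
    (hω : 0 < ω) :
    ∃ δ > 0, ∀ s ∈ Icc 0 S.T, ∀ t ∈ Icc 0 S.T, s ≤ t → t - s ≤ δ → G t - G s ≤ ω ∧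
      S.dEnergy s (y s) (y t - y s) + S.diss (y t - y s) ≤ (ε + η) * (G t - G s) := by
  obtain ⟨δ₁, hδ₁, hdiss⟩ := hy.dissipation η hη
  obtain ⟨δ₂, hδ₂, hG⟩ := Metric.uniformContinuousOn_iff_le.1
    (isCompact_Icc.uniformContinuousOn_of_continuous hy.continuousOn) ω hω
  refine ⟨min δ₁ δ₂, lt_min hδ₁ hδ₂, fun s hs t ht hst hts => ?_⟩
  refine ⟨(le_abs_self _).trans (hG t ht s hs ?_),
    hdiss s hs t ht hst (hts.trans (min_le_left _ _))⟩
  rw [Real.dist_eq, abs_of_nonneg (sub_nonneg.2 hst)]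
  exact hts.trans (min_le_right _ _)

end IsApproxSolution

namespace ConvexAssumptions

theorem dEnergy_sub_apply_sub_le (hS : S.ConvexAssumptions κ L ρ) {s ε₁ ε₂ p q : ℝ} {x y u v : Z}
    (hx : S.AlmostStable ε₁ s x) (hy : S.AlmostStable ε₂ s y)
    (hu : S.dEnergy s x u + S.diss u ≤ p) (hv : S.dEnergy s y v + S.diss v ≤ q) :
    (S.dEnergy 0 x - S.dEnergy 0 y) u - (S.dEnergy 0 x - S.dEnergy 0 y) v ≤
      p + q + ε₂ * ‖u‖ + ε₁ * ‖v‖ := by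
  simp only [sub_apply, hS.dEnergy_sub_dEnergy_apply 0 s]
  linarith [hx v, hy u]

theorem exists_bregman_energy_increment_le (hS : S.ConvexAssumptions κ L ρ) {b K : ℝ} (hb : 0 ≤ b)
    (hK : 0 ≤ K) :
    ∃ a : ℝ, 0 ≤ a ∧ ∀ (ε₁ ε₂ : ℝ) (G : ℝ → ℝ) (y w : ℝ → Z), 0 ≤ ε₁ → 0 ≤ ε₂ →
      S.IsApproxSolution ε₁ b G y → S.IsApproxSolution ε₂ b (fun t => K * t) w →
      ∀ η > 0, ∃ δ > 0, ∀ s ∈ Icc 0 S.T, ∀ t ∈ Icc 0 S.T, s ≤ t → t - s ≤ δ →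
        bregman (S.energy 0) (y t) (w t) ≤
          (1 + a * (t - s)) * bregman (S.energy 0) (y s) (w s) +
            (ε₁ + ε₂ + η) * ((G t + K * t) - (G s + K * s)) := by
  obtain ⟨Λ, hΛ⟩ := hS.exists_dEnergy_lipschitzOnWith b
  obtain ⟨M, hM, hlip₂⟩ := hS.exists_ddEnergy_lipschitz b
  have hκ := hS.κ_pos
  refine ⟨2 / κ * (M * K), by positivity, fun ε₁ ε₂ G y w hε₁ hε₂ hy hw η hη => ?_⟩
  obtain ⟨ω, hω, hηω⟩ := exists_pos_mul_lt (half_pos hη) (2 * Λ + 2 * b * M)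
  obtain ⟨δ₁, hδ₁, hy_small⟩ := hy.exists_small_increments (half_pos hη) hω
  obtain ⟨δ₂, hδ₂, hw_small⟩ := hw.exists_small_increments (half_pos hη) hω
  refine ⟨min δ₁ δ₂, lt_min hδ₁ hδ₂, fun s hs t ht hst hts => ?_⟩
  obtain ⟨hGω, hy_diss⟩ := hy_small s hs t ht hst (hts.trans (min_le_left _ _))
  obtain ⟨hKω, hw_diss⟩ := hw_small s hs t ht hst (hts.trans (min_le_right _ _))
  have hyG := hy.norm_sub_le s hs t ht hst
  have hwK := hw.norm_sub_le s hs t ht hst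
  have hdist : ‖y s - w s‖ ≤ 2 * b :=
    (norm_sub_le _ _).trans (by linarith [hy.norm_le s hs, hw.norm_le s hs])
  have mem_ball {z : Z} (hz : ‖z‖ ≤ b) : z ∈ Metric.closedBall (0 : Z) b :=
    mem_closedBall_zero_iff.2 hz
  have hexpand := bregman_le_add (hS.contDiff_energy 0) (hS.bregman_energy_nonneg 0)
    (convex_closedBall (0 : Z) b) (fun x hx y hy => hΛ.norm_sub_le hx hy) hlip₂ hM
    (mem_ball (hy.norm_le s hs)) (mem_ball (hy.norm_le t ht)) (mem_ball (hw.norm_le s hs))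
    (mem_ball (hw.norm_le t ht))
  have hcross := hS.dEnergy_sub_apply_sub_le (hy.stable s hs) (hw.stable s hs) hy_diss hw_diss
  have hquad := quadratic_error_le Λ.coe_nonneg hM (by positivity : 0 ≤ 2 * b)
    (norm_nonneg (y t - y s)) (norm_nonneg (w t - w s)) hdist hyG hwK hGω hKω
  have hgronwall : M * (‖y s - w s‖ ^ 2 * ‖w t - w s‖) ≤
      2 / κ * (M * K) * (t - s) * bregman (S.energy 0) (y s) (w s) := by
    have hbregman := hS.bregman_energy_nonneg 0 (y s) (w s)
    calc M * (‖y s - w s‖ ^ 2 * ‖w t - w s‖)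
        ≤ M * (2 / κ * bregman (S.energy 0) (y s) (w s) * (K * t - K * s)) := by
          gcongr
          exact hS.sq_norm_le_bregman_energy 0 (y s) (w s)
      _ = 2 / κ * (M * K) * (t - s) * bregman (S.energy 0) (y s) (w s) := by ring
  have hstable_y : ε₂ * ‖y t - y s‖ ≤ ε₂ * (G t - G s) := by gcongr
  have hstable_w : ε₁ * ‖w t - w s‖ ≤ ε₁ * (K * t - K * s) := by gcongr
  have hη_quad := mul_le_mul_of_nonneg_right hηω.le
    (add_nonneg ((norm_nonneg _).trans hyG) ((norm_nonneg _).trans hwK))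
  simp only [dEnergy] at hcross
  linarith

theorem exists_sq_norm_sub_le (hS : S.ConvexAssumptions κ L ρ) {b K : ℝ} (hb : 0 ≤ b) (hK : 0 ≤ K) :
    ∃ C : ℝ, ∀ (ε₁ ε₂ : ℝ) (G : ℝ → ℝ) (y w : ℝ → Z), 0 ≤ ε₁ → 0 ≤ ε₂ →
      S.IsApproxSolution ε₁ b G y → S.IsApproxSolution ε₂ b (fun t => K * t) w →
      ∀ t ∈ Icc 0 S.T, ‖y t - w t‖ ^ 2 ≤ C * ((ε₁ + ε₂) * (G S.T - G 0 + K * S.T)) := by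
  obtain ⟨a, ha, hincrement⟩ := hS.exists_bregman_energy_increment_le hb hK
  have hκ := hS.κ_pos
  refine ⟨2 / κ * Real.exp (a * S.T), fun ε₁ ε₂ G y w hε₁ hε₂ hy hw t ht => ?_⟩
  have hT := right_mem_Icc.2 hS.T_pos.le
  have hmono : MonotoneOn (fun r => G r + K * r) (Icc 0 S.T) :=
    hy.monotoneOn.add hw.monotoneOn
  have hstart : bregman (S.energy 0) (y 0) (w 0) = 0 := by
    rw [hy.initial, hw.initial, bregman_self]
  have hgronwall := le_exp_mul_of_small_increment_le ha (add_nonneg hε₁ hε₂) hstart.ge hmono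
    (hincrement ε₁ ε₂ G y w hε₁ hε₂ hy hw) ht
  simp only [hstart, zero_add, mul_zero, add_zero] at hgronwall
  calc ‖y t - w t‖ ^ 2 ≤ 2 / κ * bregman (S.energy 0) (y t) (w t) :=
        hS.sq_norm_le_bregman_energy 0 (y t) (w t)
    _ ≤ 2 / κ * ((ε₁ + ε₂) * (G t + K * t - G 0) * Real.exp (a * t)) := by gcongr
    _ ≤ 2 / κ * ((ε₁ + ε₂) * (G S.T + K * S.T - G 0) * Real.exp (a * S.T)) := by
        have htotal := hmono (left_mem_Icc.2 hS.T_pos.le) hT hS.T_pos.le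
        have hrest := hmono ht hT ht.2
        simp only [mul_zero, add_zero] at htotal hrest
        gcongr
        exact ht.2
    _ = 2 / κ * Real.exp (a * S.T) * ((ε₁ + ε₂) * (G S.T - G 0 + K * S.T)) := by ring

end ConvexAssumptions

/-! ### Differential solutions as approximate solutions -/

namespace ConvexAssumptions

theorem continuous_diss (hS : S.ConvexAssumptions κ L ρ) : Continuous S.diss := by
  refine (LipschitzWith.of_le_add_mul (ρ * ‖S.ι‖₊) fun v w => ?_).continuous
  have htriangle := hS.diss_add_le w (v - w)
  rw [add_sub_cancel] at htriangle
  rw [dist_eq_norm]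
  exact htriangle.trans (add_le_add_right (hS.diss_le_norm (v - w)) _)

theorem convexOn_diss (hS : S.ConvexAssumptions κ L ρ) : ConvexOn ℝ univ S.diss := by
  refine ⟨convex_univ, fun v _ w _ a b ha hb _ => ?_⟩
  rw [smul_eq_mul, smul_eq_mul, ← hS.diss_smul ha, ← hS.diss_smul hb]
  exact hS.diss_add_le _ _

theorem continuousOn_dEnergy (hS : S.ConvexAssumptions κ L ρ) {y : ℝ → Z}
    (hy : ContinuousOn y (Icc 0 S.T)) :
    ContinuousOn (fun t => S.dEnergy t (y t)) (Icc 0 S.T) := by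
  have hsplit : (fun t => S.dEnergy t (y t)) =
      fun t => S.dEnergy 0 (y t) - (S.ℓ t - S.ℓ 0).comp S.ι := by
    ext t w
    exact hS.dEnergy_apply 0 t (y t) w
  rw [hsplit]
  exact ((hS.continuous_dEnergy 0).comp_continuousOn hy).sub
    ((hS.ℓ_lipschitz.continuousOn.sub continuousOn_const).clm_comp continuousOn_const)

section Integral

variable {g : ℝ → Z} {s t : ℝ}

theorem intervalIntegrable_diss (hS : S.ConvexAssumptions κ L ρ)
    (hg : IntervalIntegrable g volume s t) :
    IntervalIntegrable (fun u => S.diss (g u)) volume s t := by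
  refine (hg.norm.const_mul (ρ * ‖S.ι‖)).mono_fun'
    (hS.continuous_diss.comp_aestronglyMeasurable hg.def'.aestronglyMeasurable) ?_
  exact Filter.Eventually.of_forall fun u =>
    (Real.norm_of_nonneg (hS.diss_nonneg (g u))).trans_le (hS.diss_le_norm (g u))

theorem diss_integral_le [CompleteSpace Z] (hS : S.ConvexAssumptions κ L ρ) (hst : s ≤ t)
    (hg : IntervalIntegrable g volume s t) :
    S.diss (∫ u in s..t, g u) ≤ ∫ u in s..t, S.diss (g u) := by
  rcases hst.eq_or_lt with rfl | hlt
  · simp [hS.diss_zero]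
  have hpos : 0 < (t - s)⁻¹ := inv_pos.2 (sub_pos.2 hlt)
  have hjensen := hS.convexOn_diss.map_set_average_le hS.continuous_diss.continuousOn
    isClosed_univ (μ := volume) (t := Ioc s t) (f := g) (by simp [hlt]) (by simp) (by simp)
    ((intervalIntegrable_iff_integrableOn_Ioc_of_le hst).1 hg)
    ((intervalIntegrable_iff_integrableOn_Ioc_of_le hst).1 (hS.intervalIntegrable_diss hg))
  rw [setAverage_eq, setAverage_eq, Real.volume_real_Ioc_of_le hst, hS.diss_smul hpos.le,
    smul_eq_mul] at hjensen
  rw [intervalIntegral.integral_of_le hst, intervalIntegral.integral_of_le hst]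
  exact le_of_mul_le_mul_left hjensen hpos

theorem dEnergy_integral_add_diss_integral_le [CompleteSpace Z] (hS : S.ConvexAssumptions κ L ρ)
    {y : ℝ → Z} {η : ℝ} (hst : s ≤ t) (hg : IntervalIntegrable g volume s t)
    (hbalance : ∀ᵐ u ∂volume.restrict (Icc s t), S.dEnergy u (y u) (g u) + S.diss (g u) ≤ 0)
    (hη : ∀ u ∈ Icc s t, ‖S.dEnergy u (y u) - S.dEnergy s (y s)‖ ≤ η) :
    S.dEnergy s (y s) (∫ u in s..t, g u) + S.diss (∫ u in s..t, g u) ≤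
      η * ∫ u in s..t, ‖g u‖ := by
  have hlin : IntervalIntegrable (fun u => S.dEnergy s (y s) (g u)) volume s t :=
    ⟨(S.dEnergy s (y s)).integrable_comp hg.1, (S.dEnergy s (y s)).integrable_comp hg.2⟩
  have hdiss := hS.intervalIntegrable_diss hg
  calc S.dEnergy s (y s) (∫ u in s..t, g u) + S.diss (∫ u in s..t, g u)
      ≤ (∫ u in s..t, S.dEnergy s (y s) (g u)) + ∫ u in s..t, S.diss (g u) := by
        rw [(S.dEnergy s (y s)).intervalIntegral_comp_comm hg]
        gcongr
        exact hS.diss_integral_le hst hg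
    _ = ∫ u in s..t, (S.dEnergy s (y s) (g u) + S.diss (g u)) :=
        (intervalIntegral.integral_add hlin hdiss).symm
    _ ≤ ∫ u in s..t, η * ‖g u‖ := by
        refine intervalIntegral.integral_mono_ae_restrict hst (hlin.add hdiss)
          (hg.norm.const_mul η) ?_
        filter_upwards [hbalance, ae_restrict_mem measurableSet_Icc] with u hu hmem
        have hdiff := (abs_le.1 ((S.dEnergy u (y u) - S.dEnergy s (y s)).le_of_opNorm_le
          (hη u hmem) (g u))).1
        rw [sub_apply] at hdiff
        linarith
    _ = η * ∫ u in s..t, ‖g u‖ := intervalIntegral.integral_const_mul _ _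

end Integral

theorem exists_isApproxSolution [CompleteSpace Z] (hS : S.ConvexAssumptions κ L ρ) {y : ℝ → Z}
    (hy : S.IsDifferentialSolution y) :
    ∃ G : ℝ → ℝ, S.IsApproxSolution 0 (S.stateBound κ L ρ) G y := by
  obtain ⟨hstart, g, hg, hprim, hinc⟩ := hy
  have hT := hS.T_pos
  have h0 := left_mem_Icc.2 hT.le
  have hg_int {s t : ℝ} (hs : s ∈ Icc 0 S.T) (ht : t ∈ Icc 0 S.T) :
      IntervalIntegrable g volume s t :=
    hg.mono_set (uIcc_subset_uIcc (uIcc_of_le hT.le ▸ hs) (uIcc_of_le hT.le ▸ ht))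
  have hcont : ContinuousOn (fun t => S.dEnergy t (y t)) (Icc 0 S.T) := by
    refine hS.continuousOn_dEnergy (ContinuousOn.congr (continuousOn_const.add ?_) hprim)
    rw [← uIcc_of_le hT.le]
    exact intervalIntegral.continuousOn_primitive_interval' hg left_mem_uIcc
  have hinc' := hinc.mono fun t ht => hS.inclusion_iff.1 ht
  have hstable : ∀ t ∈ Icc 0 S.T, S.AlmostStable 0 t (y t) := fun t ht w =>
    nonneg_of_ae_nonneg_of_continuousOn hT
      (((hcont.clm_apply continuousOn_const).add continuousOn_const).add continuousOn_const)
      (hinc'.mono fun _ hs => hs.1 w) t ht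
  have hincrement {s t : ℝ} (hs : s ∈ Icc 0 S.T) (ht : t ∈ Icc 0 S.T) :
      y t - y s = ∫ u in s..t, g u := by
    rw [hprim t ht, hprim s hs, add_sub_add_left_eq_sub,
      intervalIntegral.integral_interval_sub_left (hg_int h0 ht) (hg_int h0 hs)]
  have hlength {s t : ℝ} (hs : s ∈ Icc 0 S.T) (ht : t ∈ Icc 0 S.T) :
      (∫ u in (0 : ℝ)..t, ‖g u‖) - ∫ u in (0 : ℝ)..s, ‖g u‖ = ∫ u in s..t, ‖g u‖ :=
    intervalIntegral.integral_interval_sub_left (hg_int h0 ht).norm (hg_int h0 hs).norm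
  refine ⟨fun t => ∫ u in (0 : ℝ)..t, ‖g u‖, hstart, fun t ht => ?_, ?_, fun s hs t ht hst => ?_,
    hstable, fun η hη => ?_⟩
  · exact hS.norm_le_stateBound ht (by positivity) (hstable t ht)
  · rw [← uIcc_of_le hT.le]
    exact intervalIntegral.continuousOn_primitive_interval' hg.norm left_mem_uIcc
  · rw [hincrement hs ht, hlength hs ht]
    exact intervalIntegral.norm_integral_le_integral_norm hst
  · obtain ⟨δ, hδ, hclose⟩ := Metric.uniformContinuousOn_iff_le.1
      (isCompact_Icc.uniformContinuousOn_of_continuous hcont) η hη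
    refine ⟨δ, hδ, fun s hs t ht hst hts => ?_⟩
    have hsub : Icc s t ⊆ Icc 0 S.T := Icc_subset_Icc hs.1 ht.2
    rw [hlength hs ht, hincrement hs ht, zero_add]
    refine hS.dEnergy_integral_add_diss_integral_le hst (hg_int hs ht)
      (ae_restrict_of_ae_restrict_of_subset hsub (hinc'.mono fun _ hu => hu.2)) fun u hu => ?_
    rw [← dist_eq_norm]
    refine hclose u (hsub hu) s hs ?_
    rw [Real.dist_eq, abs_of_nonneg (sub_nonneg.2 hu.1)]
    linarith [hu.2]

end ConvexAssumptions

namespace IsApproxSolution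

variable {ε b K : ℝ} {y : ℝ → Z}

theorem lipschitz_nonneg (hS : S.ConvexAssumptions κ L ρ)
    (hy : S.IsApproxSolution ε b (fun t => K * t) y) : 0 ≤ K := by
  have hT := hS.T_pos
  have hlength := hy.monotoneOn (left_mem_Icc.2 hT.le) (right_mem_Icc.2 hT.le) hT.le
  simp only [mul_zero] at hlength
  exact nonneg_of_mul_nonneg_left hlength hT

theorem dEnergy_deriv_add_diss_le (hS : S.ConvexAssumptions κ L ρ)
    (hy : S.IsApproxSolution ε b (fun t => K * t) y) {t : ℝ} (ht : t ∈ Ioo 0 S.T) {v : Z}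
    (hv : HasDerivAt y v t) : S.dEnergy t (y t) v + S.diss v ≤ ε * K := by
  have hslope := (hasDerivAt_iff_tendsto_slope_zero.1 hv).mono_left
    (nhdsWithin_mono (0 : ℝ) (s := Ioi 0) fun _ hx => hx.ne')
  have hlim := (((S.dEnergy t (y t)).continuous.add hS.continuous_diss).tendsto v).comp hslope
  have hbound (η : ℝ) (hη : 0 < η) : S.dEnergy t (y t) v + S.diss v ≤ (ε + η) * K := by
    obtain ⟨δ, hδ, hdiss⟩ := hy.dissipation η hη
    refine le_of_tendsto hlim ?_
    filter_upwards [Ioo_mem_nhdsGT (lt_min hδ (sub_pos.2 ht.2))] with x hx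
    have hxδ := hx.2.trans_le (min_le_left _ _)
    have hxT := hx.2.trans_le (min_le_right _ _)
    have hstep := hdiss t (Ioo_subset_Icc_self ht) (t + x)
      ⟨by linarith [hx.1, ht.1], by linarith⟩ (by linarith [hx.1]) (by linarith)
    rw [Function.comp_apply, Pi.add_apply, map_smul, hS.diss_smul (inv_nonneg.2 hx.1.le),
      smul_eq_mul, ← mul_add, inv_mul_le_iff₀ hx.1]
    linarith
  have hlim_bound : Filter.Tendsto (fun η : ℝ => (ε + η) * K) (nhdsWithin 0 (Ioi 0))
      (nhds (ε * K)) :=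
    (Continuous.tendsto' (by fun_prop) 0 _ (by rw [add_zero])).mono_left nhdsWithin_le_nhds
  exact ge_of_tendsto hlim_bound (eventually_mem_nhdsWithin.mono hbound)

theorem isDifferentialSolution [CompleteSpace Z] (hS : S.ConvexAssumptions κ L ρ)
    (hy : S.IsApproxSolution 0 b (fun t => K * t) y) : S.IsDifferentialSolution y := by
  have hT := hS.T_pos
  have hlip : LipschitzOnWith ⟨K, hy.lipschitz_nonneg hS⟩ y (Icc 0 S.T) :=
    lipschitzOnWith_Icc_of_norm_sub_le fun s hs t ht hst =>
      (hy.norm_sub_le s hs t ht hst).trans_eq (mul_sub K t s).symm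
  obtain ⟨g, hg_int, hg⟩ := exists_eq_add_integral_of_lipschitzOnWith hT.le hlip
  refine ⟨hy.initial, g, hg_int, hg, ?_⟩
  rw [ae_restrict_congr_set Ioo_ae_eq_Icc.symm, ae_restrict_iff' measurableSet_Ioo]
  filter_upwards [hg_int.ae_hasDerivAt_integral] with t hderiv ht
  have hderiv_y : HasDerivAt y (g t) t := by
    refine ((hderiv (uIcc_of_le hT.le ▸ Ioo_subset_Icc_self ht) 0 left_mem_uIcc).const_add
      (y 0)).congr_of_eventuallyEq ?_
    filter_upwards [Icc_mem_nhds ht.1 ht.2] with s hs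
    exact hg s hs
  rw [hS.inclusion_iff]
  refine ⟨hy.stable t (Ioo_subset_Icc_self ht), ?_⟩
  simpa only [zero_mul] using hy.dEnergy_deriv_add_diss_le hS ht hderiv_y

end IsApproxSolution

/-! ### Limits of approximate solutions, and existence of iterates -/

/-- A Lipschitz continuous approximate solution with a quantitative modulus in the dissipation
inequality. In contrast to `IsApproxSolution`, these conditions pass to pointwise limits. -/
structure IsLipschitzApproxSolution (S : RateIndependentSystem Z V X) (ε b K Q : ℝ) (y : ℝ → Z) :
    Prop where
  initial : y 0 = S.z₀
  norm_le : ∀ t ∈ Icc 0 S.T, ‖y t‖ ≤ b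
  norm_sub_le : ∀ s ∈ Icc 0 S.T, ∀ t ∈ Icc 0 S.T, s ≤ t → ‖y t - y s‖ ≤ K * (t - s)
  stable : ∀ t ∈ Icc 0 S.T, S.AlmostStable ε t (y t)
  dissipation : ∀ s ∈ Icc 0 S.T, ∀ t ∈ Icc 0 S.T, s ≤ t →
    S.dEnergy s (y s) (y t - y s) + S.diss (y t - y s) ≤ (ε + Q * (t - s)) * (K * (t - s))

theorem IsLipschitzApproxSolution.isApproxSolution {ε b K Q : ℝ} {y : ℝ → Z} (hK : 0 ≤ K)
    (hQ : 0 ≤ Q) (hy : S.IsLipschitzApproxSolution ε b K Q y) :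
    S.IsApproxSolution ε b (fun t => K * t) y := by
  refine ⟨hy.initial, hy.norm_le, by fun_prop, fun s hs t ht hst => ?_, hy.stable,
    fun η hη => ⟨η / (Q + 1), by positivity, fun s hs t ht hst hδ => ?_⟩⟩
  · rw [← mul_sub]
    exact hy.norm_sub_le s hs t ht hst
  · have hts : 0 ≤ t - s := sub_nonneg.2 hst
    have hmodulus : Q * (t - s) ≤ η := by
      rw [le_div_iff₀ (by positivity)] at hδ
      linarith
    refine (hy.dissipation s hs t ht hst).trans ?_
    rw [← mul_sub]
    gcongr

/-- The states among which the scheme with step size `τ` selects the successor of `z`. -/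
def feasibleSet (S : RateIndependentSystem Z V X) (τ : ℝ) (z : Z) : Set Z :=
  {w | ‖S.ι (w - z)‖ ≤ τ}

theorem feasibleSet_eq_preimage (S : RateIndependentSystem Z V X) (τ : ℝ) (z : Z) :
    S.feasibleSet τ z = S.ι ⁻¹' Metric.closedBall (S.ι z) τ := by
  ext w
  rw [mem_preimage, mem_closedBall_iff_norm, ← map_sub, feasibleSet, mem_ofPred_eq]

theorem convex_feasibleSet (S : RateIndependentSystem Z V X) (τ : ℝ) (z : Z) :
    Convex ℝ (S.feasibleSet τ z) := by
  rw [feasibleSet_eq_preimage]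
  exact (convex_closedBall (S.ι z) τ).linear_preimage S.ι.toLinearMap

theorem isClosed_feasibleSet (S : RateIndependentSystem Z V X) (τ : ℝ) (z : Z) :
    IsClosed (S.feasibleSet τ z) := by
  rw [feasibleSet_eq_preimage]
  exact Metric.isClosed_closedBall.preimage S.ι.continuous

namespace ConvexAssumptions

section Limit

variable {b K Q : ℝ} {ε : ℕ → ℝ} {y : ℕ → ℝ → Z}

theorem cauchySeq_of_isLipschitzApproxSolution (hS : S.ConvexAssumptions κ L ρ) (hb : 0 ≤ b)
    (hK : 0 ≤ K) (hQ : 0 ≤ Q) (hε : ∀ n, 0 ≤ ε n)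
    (hlim : Filter.Tendsto ε Filter.atTop (nhds 0))
    (hy : ∀ n, S.IsLipschitzApproxSolution (ε n) b K Q (y n)) {t : ℝ} (ht : t ∈ Icc 0 S.T) :
    CauchySeq fun n => y n t := by
  obtain ⟨C, hcomp⟩ := hS.exists_sq_norm_sub_le hb hK
  have hsolution (n : ℕ) := (hy n).isApproxSolution hK hQ
  rw [cauchySeq_iff_tendsto_dist_atTop_0]
  refine squeeze_zero (g := fun n : ℕ × ℕ =>
    √(C * ((ε n.1 + ε n.2) * (K * S.T - K * 0 + K * S.T)))) (fun _ => dist_nonneg) (fun n => ?_) ?_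
  · rw [dist_eq_norm]
    exact Real.le_sqrt_of_sq_le
      (hcomp _ _ _ _ _ (hε n.1) (hε n.2) (hsolution n.1) (hsolution n.2) t ht)
  · rw [← Filter.prod_atTop_atTop_eq]
    simpa using ((((hlim.comp Filter.tendsto_fst).add (hlim.comp Filter.tendsto_snd)).mul_const
      (K * S.T - K * 0 + K * S.T)).const_mul C).sqrt

theorem isLipschitzApproxSolution_of_tendsto (hS : S.ConvexAssumptions κ L ρ)
    (hlim : Filter.Tendsto ε Filter.atTop (nhds 0))
    (hy : ∀ n, S.IsLipschitzApproxSolution (ε n) b K Q (y n)) {z : ℝ → Z}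
    (hz : ∀ t ∈ Icc 0 S.T, Filter.Tendsto (fun n => y n t) Filter.atTop (nhds (z t))) :
    S.IsLipschitzApproxSolution 0 b K Q z := by
  have hdE (t : ℝ) (ht : t ∈ Icc 0 S.T) :
      Filter.Tendsto (fun n => S.dEnergy t (y n t)) Filter.atTop (nhds (S.dEnergy t (z t))) :=
    ((hS.continuous_dEnergy t).tendsto _).comp (hz t ht)
  refine ⟨tendsto_nhds_unique (hz 0 (left_mem_Icc.2 hS.T_pos.le)) ?_, fun t ht => ?_,
    fun s hs t ht hst => ?_, fun t ht w => ?_, fun s hs t ht hst => ?_⟩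
  · simp only [(hy _).initial, tendsto_const_nhds_iff]
  · exact le_of_tendsto' (hz t ht).norm fun n => (hy n).norm_le t ht
  · exact le_of_tendsto' ((hz t ht).sub (hz s hs)).norm fun n => (hy n).norm_sub_le s hs t ht hst
  · have hforce := tendsto_clm_apply (hdE t ht) (tendsto_const_nhds (x := w))
    exact ge_of_tendsto' ((hforce.add_const (S.diss w)).add (hlim.mul_const ‖w‖))
      fun n => (hy n).stable t ht w
  · have hincrement := (hz t ht).sub (hz s hs)
    exact le_of_tendsto_of_tendsto' ((tendsto_clm_apply (hdE s hs) hincrement).add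
      ((hS.continuous_diss.tendsto _).comp hincrement))
      ((hlim.add_const (Q * (t - s))).mul_const (K * (t - s)))
      fun n => (hy n).dissipation s hs t ht hst

theorem exists_isLipschitzApproxSolution_zero [CompleteSpace Z] (hS : S.ConvexAssumptions κ L ρ)
    (hb : 0 ≤ b) (hK : 0 ≤ K) (hQ : 0 ≤ Q) (hε : ∀ n, 0 ≤ ε n)
    (hlim : Filter.Tendsto ε Filter.atTop (nhds 0))
    (hy : ∀ n, S.IsLipschitzApproxSolution (ε n) b K Q (y n)) :
    ∃ z : ℝ → Z, S.IsLipschitzApproxSolution 0 b K Q z := by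
  have hpointwise (t : ℝ) (ht : t ∈ Icc 0 S.T) :=
    cauchySeq_tendsto_of_complete (hS.cauchySeq_of_isLipschitzApproxSolution hb hK hQ hε hlim hy ht)
  choose! z hz using hpointwise
  exact ⟨z, hS.isLipschitzApproxSolution_of_tendsto hlim hy hz⟩

end Limit

theorem le_energy (hS : S.ConvexAssumptions κ L ρ) (t : ℝ) (w : Z) :
    S.energy t 0 - ‖S.dEnergy t 0‖ ^ 2 / (2 * κ) ≤ S.energy t w := by
  have hκ := hS.κ_pos
  have htangent := hS.half_mul_sq_norm_le_bregman_energy t w 0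
  rw [bregman, sub_zero] at htangent
  have hslope := (abs_le.1 ((S.dEnergy t 0).le_opNorm w)).1
  rw [dEnergy] at hslope ⊢
  have hyoung : ‖fderiv ℝ (S.energy t) 0‖ * ‖w‖ - κ / 2 * ‖w‖ ^ 2 ≤
      ‖fderiv ℝ (S.energy t) 0‖ ^ 2 / (2 * κ) := by
    rw [le_div_iff₀ (by positivity)]
    linarith [sq_nonneg (‖fderiv ℝ (S.energy t) 0‖ - κ * ‖w‖)]
  linarith

theorem convexOn_diss_sub (hS : S.ConvexAssumptions κ L ρ) (z : Z) :
    ConvexOn ℝ univ fun w => S.diss (w - z) := by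
  simpa only [sub_eq_add_neg] using! hS.convexOn_diss.translate_left (-z)

theorem exists_minimizer [CompleteSpace Z] (hS : S.ConvexAssumptions κ L ρ) {τ : ℝ} (hτ : 0 ≤ τ)
    (t : ℝ) (z : Z) :
    ∃ x ∈ S.feasibleSet τ z, IsMinOn (fun w => S.energy t w + S.diss (w - z)) (S.feasibleSet τ z) x
    := by
  have hstrong : StrongConvexOn univ κ fun w => S.energy t w + S.diss (w - z) := by
    simpa only [add_zero] using! UniformConvexOn.add
      (strongConvexOn_of_half_mul_sq_norm_le_bregman (hS.half_mul_sq_norm_le_bregman_energy t))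
      (uniformConvexOn_zero.2 (hS.convexOn_diss_sub z))
  refine exists_isMinOn_of_strongConvexOn hS.κ_pos
    ⟨S.convex_feasibleSet τ z, fun _ _ _ _ => hstrong.2 trivial trivial⟩
    ((hS.differentiable_energy t).continuous.add
      (hS.continuous_diss.comp (continuous_sub_right z))).continuousOn
    (S.isClosed_feasibleSet τ z) ⟨z, by simpa [feasibleSet] using hτ⟩
    ⟨S.energy t 0 - ‖S.dEnergy t 0‖ ^ 2 / (2 * κ), ?_⟩
  rintro _ ⟨w, -, rfl⟩
  exact (hS.le_energy t w).trans (le_add_of_nonneg_right (hS.diss_nonneg _))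

theorem exists_isLocalMinScheme [CompleteSpace Z] (hS : S.ConvexAssumptions κ L ρ) {τ : ℝ}
    (hτ : 0 ≤ τ) : ∃ (t : ℕ → ℝ) (z : ℕ → Z), S.IsLocalMinScheme τ t z := by
  choose x hfeasible hmin using hS.exists_minimizer hτ
  let iterate : ℕ → ℝ × Z := fun n => Nat.rec (0, S.z₀)
    (fun _ p => (min (p.1 + τ - ‖S.ι (x p.1 p.2 - p.2)‖) S.T, x p.1 p.2)) n
  exact ⟨fun n => (iterate n).1, fun n => (iterate n).2,
    { t_zero := rfl
      z_zero := rfl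
      feasible := fun _ => hfeasible _ _
      minimal := fun _ => hmin _ _
      t_succ := fun _ => rfl }⟩

end ConvexAssumptions

/-! ### Multipliers of the scheme and stalls -/

/-- The Lagrange multiplier of the constraint `‖z_k - z_{k-1}‖ ≤ τ`, measured in the dual norm of
`V`. There is no constraint on the initial state, whose multiplier is `0`. -/
noncomputable def multiplier (S : RateIndependentSystem Z V X) (τ : ℝ) (t : ℕ → ℝ) (z : ℕ → Z) :
    ℕ → ℝ
  | 0 => 0
  | k + 1 => -(S.dEnergy (t k) (z (k + 1)) (z (k + 1) - z k) + S.diss (z (k + 1) - z k)) / τ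

/-- A bound, in the dual norm of `V`, for the violation of local stability by `z_k` at time `t_k`:
the multiplier accounts for stability at time `t_{k-1}`, the second term for the change of the
load. -/
noncomputable def instability (S : RateIndependentSystem Z V X) (τ : ℝ) (L : ℝ≥0) (t : ℕ → ℝ)
    (z : ℕ → Z) (k : ℕ) : ℝ :=
  S.multiplier τ t z k + L * (t k - t (k - 1))

namespace IsLocalMinScheme

variable {τ : ℝ} {t : ℕ → ℝ} {z : ℕ → Z}

theorem t_mem (hs : S.IsLocalMinScheme τ t z) (hT : 0 ≤ S.T) (k : ℕ) : t k ∈ Icc 0 S.T := by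
  induction k with
  | zero =>
    rw [hs.t_zero]
    exact left_mem_Icc.2 hT
  | succ k ih =>
    rw [hs.t_succ]
    exact ⟨le_min (by linarith [ih.1, hs.feasible k]) hT, min_le_right _ _⟩

theorem t_monotone (hs : S.IsLocalMinScheme τ t z) (hT : 0 ≤ S.T) : Monotone t := by
  refine monotone_nat_of_le_succ fun k => ?_
  rw [hs.t_succ]
  exact le_min (by linarith [hs.feasible k]) (hs.t_mem hT k).2

theorem t_pred_le (hs : S.IsLocalMinScheme τ t z) (hT : 0 ≤ S.T) (k : ℕ) : t (k - 1) ≤ t k :=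
  hs.t_monotone hT (Nat.sub_le k 1)

theorem t_succ_le (hs : S.IsLocalMinScheme τ t z) (k : ℕ) :
    t (k + 1) ≤ t k + τ - ‖S.ι (z (k + 1) - z k)‖ :=
  (hs.t_succ k).trans_le (min_le_left _ _)

theorem t_sub_pred_le (hs : S.IsLocalMinScheme τ t z) (hτ : 0 ≤ τ) (k : ℕ) :
    t k - t (k - 1) ≤ τ := by
  cases k with
  | zero => simpa using hτ
  | succ k =>
    rw [Nat.add_sub_cancel]
    linarith [hs.t_succ_le k, norm_nonneg (S.ι (z (k + 1) - z k))]

theorem norm_lt_of_t_lt (hs : S.IsLocalMinScheme τ t z) {k : ℕ} (hk : t k < t (k + 1)) :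
    ‖S.ι (z (k + 1) - z k)‖ < τ := by
  linarith [hs.t_succ_le k]

theorem variational_inequality (hs : S.IsLocalMinScheme τ t z) (hS : S.ConvexAssumptions κ L ρ)
    (k : ℕ) {w : Z} (hw : ‖S.ι w‖ ≤ τ) :
    S.diss (z (k + 1) - z k) - S.diss w ≤
      S.dEnergy (t k) (z (k + 1)) (w - (z (k + 1) - z k)) := by
  have hfeasible : z k + w ∈ S.feasibleSet τ (z k) := by
    simpa only [feasibleSet, mem_ofPred_eq, add_sub_cancel_left] using hw
  have hopt := sub_le_fderiv_of_isMinOn_add (hS.differentiable_energy (t k) (z (k + 1)))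
    ((hS.convexOn_diss_sub (z k)).subset (subset_univ _) (S.convex_feasibleSet τ (z k)))
    (hs.minimal k) (hs.feasible k) hfeasible
  rwa [add_sub_cancel_left, add_comm (z k), add_sub_assoc, ← neg_sub (z (k + 1)),
    ← sub_eq_add_neg] at hopt

theorem multiplier_succ_mul (hτ : τ ≠ 0) (k : ℕ) :
    S.multiplier τ t z (k + 1) * τ =
      -(S.dEnergy (t k) (z (k + 1)) (z (k + 1) - z k) + S.diss (z (k + 1) - z k)) :=
  div_mul_cancel₀ _ hτ

theorem multiplier_nonneg (hs : S.IsLocalMinScheme τ t z) (hS : S.ConvexAssumptions κ L ρ)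
    (hτ : 0 < τ) (k : ℕ) : 0 ≤ S.multiplier τ t z k := by
  cases k with
  | zero => exact le_rfl
  | succ k =>
    have htest := hs.variational_inequality hS k (w := 0) (by simpa using hτ.le)
    rw [zero_sub, map_neg, hS.diss_zero] at htest
    exact div_nonneg (by linarith) hτ.le

theorem multiplier_eq_zero (hs : S.IsLocalMinScheme τ t z) (hS : S.ConvexAssumptions κ L ρ)
    (hτ : 0 < τ) {k : ℕ} (hk : ‖S.ι (z (k + 1) - z k)‖ < τ) :
    S.multiplier τ t z (k + 1) = 0 := by
  refine le_antisymm ?_ (hs.multiplier_nonneg hS hτ _)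
  set d := z (k + 1) - z k
  set r := (τ - ‖S.ι d‖) / τ
  have hr : 0 < r := div_pos (sub_pos.2 hk) hτ
  have hrτ : r * τ = τ - ‖S.ι d‖ := div_mul_cancel₀ _ hτ.ne'
  have hfeasible : ‖S.ι ((1 + r) • d)‖ ≤ τ := by
    rw [map_smul, norm_smul, Real.norm_of_nonneg (by positivity)]
    linarith [mul_le_mul_of_nonneg_left hk.le hr.le]
  have htest := hs.variational_inequality hS k hfeasible
  rw [hS.diss_smul (by positivity), show (1 + r) • d - d = r • d by module, map_smul,
    smul_eq_mul] at htest
  have hpos : 0 ≤ r * (S.dEnergy (t k) (z (k + 1)) d + S.diss d) := by linarith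
  exact div_nonpos_of_nonpos_of_nonneg
    (neg_nonpos.2 (nonneg_of_mul_nonneg_right hpos hr)) hτ.le

theorem multiplier_eq_zero_of_t_lt (hs : S.IsLocalMinScheme τ t z)
    (hS : S.ConvexAssumptions κ L ρ) (hτ : 0 < τ) {k : ℕ} (hk : t (k - 1) < t k) :
    S.multiplier τ t z k = 0 := by
  cases k with
  | zero => rfl
  | succ k => exact hs.multiplier_eq_zero hS hτ (hs.norm_lt_of_t_lt hk)

theorem dissipation_eq (hs : S.IsLocalMinScheme τ t z) (hS : S.ConvexAssumptions κ L ρ)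
    (hτ : 0 < τ) (k : ℕ) :
    S.dEnergy (t k) (z (k + 1)) (z (k + 1) - z k) + S.diss (z (k + 1) - z k) =
      -(S.multiplier τ t z (k + 1) * ‖S.ι (z (k + 1) - z k)‖) := by
  rw [← neg_eq_iff_eq_neg, ← multiplier_succ_mul hτ.ne']
  rcases (hs.feasible k).lt_or_eq with hlt | heq
  · rw [hs.multiplier_eq_zero hS hτ hlt, zero_mul, zero_mul]
  · rw [heq]

theorem stable_succ_up_to_multiplier (hs : S.IsLocalMinScheme τ t z)
    (hS : S.ConvexAssumptions κ L ρ) (hτ : 0 < τ) (k : ℕ) (w : Z) :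
    0 ≤ S.dEnergy (t k) (z (k + 1)) w + S.diss w + S.multiplier τ t z (k + 1) * ‖S.ι w‖ := by
  rcases (norm_nonneg (S.ι w)).eq_or_lt with hw | hw
  · have hιw : S.ι w = 0 := norm_eq_zero.1 hw.symm
    have htest := hs.variational_inequality hS k (w := z (k + 1) - z k + w) (by
      rw [map_add, hιw, add_zero]
      exact hs.feasible k)
    rw [add_sub_cancel_left] at htest
    rw [← hw, mul_zero, add_zero]
    linarith [hS.diss_add_le (z (k + 1) - z k) w]
  · have hr : 0 < τ / ‖S.ι w‖ := div_pos hτ hw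
    have hscale : τ / ‖S.ι w‖ * ‖S.ι w‖ = τ := div_mul_cancel₀ _ hw.ne'
    have htest := hs.variational_inequality hS k (w := (τ / ‖S.ι w‖) • w) (by
      rw [map_smul, norm_smul, Real.norm_of_nonneg hr.le, hscale])
    rw [map_sub, map_smul, hS.diss_smul hr.le, smul_eq_mul] at htest
    refine (mul_nonneg_iff_of_pos_left hr).1 ?_
    have hμ := multiplier_succ_mul (S := S) (t := t) (z := z) hτ.ne' k
    linear_combination htest - S.multiplier τ t z (k + 1) * hscale - hμ

theorem stable_up_to_instability (hs : S.IsLocalMinScheme τ t z)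
    (hS : S.ConvexAssumptions κ L ρ) (hτ : 0 < τ) (k : ℕ) (w : Z) :
    0 ≤ S.dEnergy (t k) (z k) w + S.diss w + S.instability τ L t z k * ‖S.ι w‖ := by
  have hpred : 0 ≤ S.dEnergy (t (k - 1)) (z k) w + S.diss w +
      S.multiplier τ t z k * ‖S.ι w‖ := by
    cases k with
    | zero =>
      rw [Nat.zero_sub, hs.t_zero, hs.z_zero, multiplier, zero_mul, add_zero]
      simpa only [zero_mul, add_zero] using hS.locallyStable_iff.1 hS.z₀_stable w
    | succ k => exact hs.stable_succ_up_to_multiplier hS hτ k w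
  have hload := (abs_le.1 (hS.abs_load_sub_le (hs.t_mem hS.T_pos.le (k - 1))
    (hs.t_mem hS.T_pos.le k) w)).2
  rw [abs_of_nonneg (sub_nonneg.2 (hs.t_pred_le hS.T_pos.le k))] at hload
  rw [hS.dEnergy_apply (t (k - 1)), instability, add_mul]
  linarith

theorem instability_nonneg (hs : S.IsLocalMinScheme τ t z) (hS : S.ConvexAssumptions κ L ρ)
    (hτ : 0 < τ) (k : ℕ) : 0 ≤ S.instability τ L t z k :=
  add_nonneg (hs.multiplier_nonneg hS hτ k)
    (mul_nonneg L.2 (sub_nonneg.2 (hs.t_pred_le hS.T_pos.le k)))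

theorem sq_norm_step_le (hs : S.IsLocalMinScheme τ t z) (hS : S.ConvexAssumptions κ L ρ)
    (hτ : 0 < τ) (k : ℕ) : κ * ‖z (k + 1) - z k‖ ^ 2 ≤
      (S.instability τ L t z k - S.multiplier τ t z (k + 1)) * ‖S.ι (z (k + 1) - z k)‖ := by
  linarith [hs.stable_up_to_instability hS hτ k (z (k + 1) - z k), hs.dissipation_eq hS hτ k,
    hS.dEnergy_strongly_monotone (t k) (z (k + 1)) (z k)]

theorem multiplier_succ_le (hs : S.IsLocalMinScheme τ t z) (hS : S.ConvexAssumptions κ L ρ)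
    (hτ : 0 < τ) (k : ℕ) : S.multiplier τ t z (k + 1) ≤ S.instability τ L t z k := by
  rcases (norm_nonneg (S.ι (z (k + 1) - z k))).eq_or_lt with hstep | hstep
  · rw [hs.multiplier_eq_zero hS hτ (hstep ▸ hτ)]
    exact hs.instability_nonneg hS hτ k
  · have hκ := hS.κ_pos
    exact sub_nonneg.1 (nonneg_of_mul_nonneg_left
      ((by positivity : 0 ≤ κ * ‖z (k + 1) - z k‖ ^ 2).trans (hs.sq_norm_step_le hS hτ k)) hstep)

theorem norm_step_le_sub (hs : S.IsLocalMinScheme τ t z) (hS : S.ConvexAssumptions κ L ρ)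
    (hτ : 0 < τ) (k : ℕ) : κ * ‖z (k + 1) - z k‖ ≤
      ‖S.ι‖ * (S.instability τ L t z k - S.multiplier τ t z (k + 1)) := by
  have hdecay := sub_nonneg.2 (hs.multiplier_succ_le hS hτ k)
  rcases (norm_nonneg (z (k + 1) - z k)).eq_or_lt with hstep | hstep
  · rw [← hstep, mul_zero]
    positivity
  · refine le_of_mul_le_mul_right ?_ hstep
    linarith [hs.sq_norm_step_le hS hτ k,
      mul_le_mul_of_nonneg_left (S.ι.le_opNorm (z (k + 1) - z k)) hdecay]

theorem norm_step_le (hs : S.IsLocalMinScheme τ t z) (hS : S.ConvexAssumptions κ L ρ)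
    (hτ : 0 < τ) (k : ℕ) :
    ‖z (k + 1) - z k‖ ≤ ‖S.ι‖ / κ * S.instability τ L t z k := by
  rw [div_mul_eq_mul_div, le_div_iff₀' hS.κ_pos]
  refine (hs.norm_step_le_sub hS hτ k).trans ?_
  gcongr
  exact sub_le_self _ (hs.multiplier_nonneg hS hτ (k + 1))

theorem norm_ι_step_le_sub (hs : S.IsLocalMinScheme τ t z) (hS : S.ConvexAssumptions κ L ρ)
    (hτ : 0 < τ) (k : ℕ) : κ * ‖S.ι (z (k + 1) - z k)‖ ≤
      ‖S.ι‖ ^ 2 * (S.instability τ L t z k - S.multiplier τ t z (k + 1)) :=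
  have hκ := hS.κ_pos
  calc κ * ‖S.ι (z (k + 1) - z k)‖ ≤ κ * (‖S.ι‖ * ‖z (k + 1) - z k‖) := by
        gcongr
        exact S.ι.le_opNorm _
    _ = ‖S.ι‖ * (κ * ‖z (k + 1) - z k‖) := by ring
    _ ≤ ‖S.ι‖ * (‖S.ι‖ * (S.instability τ L t z k - S.multiplier τ t z (k + 1))) :=
        mul_le_mul_of_nonneg_left (hs.norm_step_le_sub hS hτ k) (norm_nonneg _)
    _ = ‖S.ι‖ ^ 2 * (S.instability τ L t z k - S.multiplier τ t z (k + 1)) := by ring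

theorem instability_le (hs : S.IsLocalMinScheme τ t z) (hS : S.ConvexAssumptions κ L ρ)
    (hτ : 0 < τ) (k : ℕ) : S.instability τ L t z k ≤ L * S.T := by
  induction k with
  | zero => simpa [instability, multiplier] using mul_nonneg L.2 hS.T_pos.le
  | succ k ih =>
    rcases (hs.t_pred_le hS.T_pos.le (k + 1)).eq_or_lt with heq | hlt
    · rw [instability, heq, sub_self, mul_zero, add_zero]
      exact (hs.multiplier_succ_le hS hτ k).trans ih
    · rw [instability, hs.multiplier_eq_zero_of_t_lt hS hτ hlt, zero_add]
      gcongr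
      linarith [(hs.t_mem hS.T_pos.le (k + 1)).2, (hs.t_mem hS.T_pos.le (k + 1 - 1)).1]

theorem norm_le (hs : S.IsLocalMinScheme τ t z) (hS : S.ConvexAssumptions κ L ρ) (hτ : 0 < τ)
    (k : ℕ) : ‖z k‖ ≤ S.stateBound κ L ρ := by
  refine hS.norm_le_stateBound (hs.t_mem hS.T_pos.le k) le_rfl fun w => ?_
  refine (hs.stable_up_to_instability hS hτ k w).trans (add_le_add_right ?_ _)
  have hT := hS.T_pos
  calc S.instability τ L t z k * ‖S.ι w‖ ≤ L * S.T * (‖S.ι‖ * ‖w‖) := by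
        gcongr
        · exact hs.instability_le hS hτ k
        · exact S.ι.le_opNorm w
    _ = L * S.T * ‖S.ι‖ * ‖w‖ := by ring

theorem sum_steps_le (hs : S.IsLocalMinScheme τ t z) (hS : S.ConvexAssumptions κ L ρ)
    (hτ : 0 < τ) (n : ℕ) : ‖S.ι‖ ^ 2 * S.instability τ L t z n +
      κ * ∑ k ∈ Finset.range n, ‖S.ι (z (k + 1) - z k)‖ ≤ ‖S.ι‖ ^ 2 * (L * t n) := by
  induction n with
  | zero => simp [instability, multiplier, hs.t_zero]
  | succ n ih =>
    have hstep := hs.norm_ι_step_le_sub hS hτ n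
    rw [Finset.sum_range_succ, instability, Nat.add_sub_cancel]
    linarith

theorem exists_t_eq (hs : S.IsLocalMinScheme τ t z) (hS : S.ConvexAssumptions κ L ρ)
    (hτ : 0 < τ) : ∃ k, t k = S.T := by
  by_contra! hne
  have ht_succ (k : ℕ) : t (k + 1) = t k + τ - ‖S.ι (z (k + 1) - z k)‖ :=
    (min_choice _ _).elim (hs.t_succ k).trans fun h => absurd ((hs.t_succ k).trans h) (hne _)
  have hsum (n : ℕ) : ∑ k ∈ Finset.range n, ‖S.ι (z (k + 1) - z k)‖ = n * τ - t n := by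
    induction n with
    | zero => simp [hs.t_zero]
    | succ n ih =>
      rw [Finset.sum_range_succ, ih, ht_succ]
      push_cast
      ring
  obtain ⟨n, hn⟩ := exists_nat_gt ((κ * S.T + ‖S.ι‖ ^ 2 * (L * S.T)) / (κ * τ))
  have hκ := hS.κ_pos
  rw [div_lt_iff₀ (by positivity)] at hn
  have hle := hs.sum_steps_le hS hτ n
  rw [hsum] at hle
  have htn := (hs.t_mem hS.T_pos.le n).2
  have hinst := hs.instability_nonneg hS hτ n
  have hload : ‖S.ι‖ ^ 2 * (L * t n) ≤ ‖S.ι‖ ^ 2 * (L * S.T) := by gcongr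
  have hnonneg : 0 ≤ ‖S.ι‖ ^ 2 * S.instability τ L t z n := by positivity
  have hκt : κ * t n ≤ κ * S.T := by gcongr
  linarith

end IsLocalMinScheme

/-- A bound for the number of consecutive steps of the scheme without progress in time. -/
noncomputable def stallBound (S : RateIndependentSystem Z V X) (κ : ℝ) (L : ℝ≥0) : ℕ :=
  ⌈L * ‖S.ι‖ ^ 2 / κ⌉₊ + 1

/-- A bound for the ratio of the change of the state in a stall to the time step before it. -/
noncomputable def slopeBound (S : RateIndependentSystem Z V X) (κ : ℝ) (L : ℝ≥0) : ℝ :=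
  S.stallBound κ L * (‖S.ι‖ / κ * L)

/-- The steps from `k₀` to `k₁` start with a vanishing multiplier, and all of them but possibly the
last one use up the step size `τ` and make no progress in time. -/
structure IsStall (S : RateIndependentSystem Z V X) (τ : ℝ) (t : ℕ → ℝ) (z : ℕ → Z)
    (k₀ k₁ : ℕ) : Prop where
  lt : k₀ < k₁
  multiplier_eq_zero : S.multiplier τ t z k₀ = 0
  active : ∀ k, k₀ ≤ k → k + 1 < k₁ → ‖S.ι (z (k + 1) - z k)‖ = τ ∧ t (k + 1) = t k

theorem ConvexAssumptions.slopeBound_nonneg (hS : S.ConvexAssumptions κ L ρ) :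
    0 ≤ S.slopeBound κ L := by
  have := hS.κ_pos
  rw [slopeBound]
  positivity

namespace IsStall

variable {τ : ℝ} {t : ℕ → ℝ} {z : ℕ → Z} {k₀ k₁ k : ℕ}

theorem t_eq (hst : S.IsStall τ t z k₀ k₁) (hk₀ : k₀ ≤ k) : k < k₁ → t k = t k₀ := by
  induction k, hk₀ using Nat.le_induction with
  | base => exact fun _ => rfl
  | succ k hk₀ ih => exact fun hk => (hst.active k hk₀ hk).2.trans (ih (k.lt_succ_self.trans hk))

theorem instability_start (hst : S.IsStall τ t z k₀ k₁) :
    S.instability τ L t z k₀ = L * (t k₀ - t (k₀ - 1)) := by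
  rw [instability, hst.multiplier_eq_zero, zero_add]

theorem instability_succ (hst : S.IsStall τ t z k₀ k₁) (hk₀ : k₀ ≤ k) (hk : k + 1 < k₁) :
    S.instability τ L t z (k + 1) = S.multiplier τ t z (k + 1) := by
  rw [instability, Nat.add_sub_cancel, (hst.active k hk₀ hk).2, sub_self, mul_zero, add_zero]

theorem instability_le (hst : S.IsStall τ t z k₀ k₁) (hs : S.IsLocalMinScheme τ t z)
    (hS : S.ConvexAssumptions κ L ρ) (hτ : 0 < τ) (hk₀ : k₀ ≤ k) :
    k < k₁ → S.instability τ L t z k ≤ L * (t k₀ - t (k₀ - 1)) := by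
  induction k, hk₀ using Nat.le_induction with
  | base => exact fun _ => hst.instability_start.le
  | succ k hk₀ ih =>
    intro hk
    rw [hst.instability_succ hk₀ hk]
    exact (hs.multiplier_succ_le hS hτ k).trans (ih (k.lt_succ_self.trans hk))

theorem instability_add_le (hst : S.IsStall τ t z k₀ k₁) (hs : S.IsLocalMinScheme τ t z)
    (hS : S.ConvexAssumptions κ L ρ) (hτ : 0 < τ) (hk₀ : k₀ ≤ k) :
    k < k₁ → ‖S.ι‖ ^ 2 * S.instability τ L t z k + (k - k₀) * (κ * τ) ≤
      ‖S.ι‖ ^ 2 * (L * (t k₀ - t (k₀ - 1))) := by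
  induction k, hk₀ using Nat.le_induction with
  | base => intro; rw [hst.instability_start, sub_self, zero_mul, add_zero]
  | succ k hk₀ ih =>
    intro hk
    have hdecay := hs.norm_ι_step_le_sub hS hτ k
    rw [(hst.active k hk₀ hk).1, ← hst.instability_succ (L := L) hk₀ hk] at hdecay
    push_cast
    linarith [ih (k.lt_succ_self.trans hk)]

theorem length_le (hst : S.IsStall τ t z k₀ k₁) (hs : S.IsLocalMinScheme τ t z)
    (hS : S.ConvexAssumptions κ L ρ) (hτ : 0 < τ) : k₁ ≤ k₀ + S.stallBound κ L := by
  obtain ⟨k, rfl⟩ : ∃ k, k₁ = k + 1 := Nat.exists_eq_succ_of_ne_zero hst.lt.ne_bot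
  have hdecay := hst.instability_add_le hs hS hτ (Nat.le_of_lt_succ hst.lt) k.lt_succ_self
  have hinst := mul_nonneg (sq_nonneg ‖S.ι‖) (hs.instability_nonneg hS hτ k)
  have htime : ‖S.ι‖ ^ 2 * (L * (t k₀ - t (k₀ - 1))) ≤ ‖S.ι‖ ^ 2 * (L * τ) := by
    gcongr
    exact hs.t_sub_pred_le hτ.le k₀
  have hcount : (k : ℝ) - k₀ ≤ L * ‖S.ι‖ ^ 2 / κ := by
    rw [le_div_iff₀ hS.κ_pos]
    refine le_of_mul_le_mul_right ?_ hτ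
    linarith
  have hceil := hcount.trans (Nat.le_ceil _)
  rw [sub_le_iff_le_add'] at hceil
  rw [stallBound, ← add_assoc]
  exact Nat.succ_le_succ (mod_cast hceil)

theorem norm_step_le (hst : S.IsStall τ t z k₀ k₁) (hs : S.IsLocalMinScheme τ t z)
    (hS : S.ConvexAssumptions κ L ρ) (hτ : 0 < τ) (hk₀ : k₀ ≤ k) (hk : k < k₁) :
    ‖z (k + 1) - z k‖ ≤ ‖S.ι‖ / κ * (L * (t k₀ - t (k₀ - 1))) := by
  have hκ := hS.κ_pos
  refine (hs.norm_step_le hS hτ k).trans ?_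
  gcongr
  exact hst.instability_le hs hS hτ hk₀ hk

theorem length_mul_le (hst : S.IsStall τ t z k₀ k₁) (hs : S.IsLocalMinScheme τ t z)
    (hS : S.ConvexAssumptions κ L ρ) (hτ : 0 < τ) {n : ℕ} (hn : n ≤ k₁ - k₀) :
    n * (‖S.ι‖ / κ * (L * (t k₀ - t (k₀ - 1)))) ≤ S.slopeBound κ L * (t k₀ - t (k₀ - 1)) := by
  have hlength : n ≤ S.stallBound κ L :=
    hn.trans (Nat.sub_le_iff_le_add'.2 (hst.length_le hs hS hτ))
  have hκ := hS.κ_pos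
  have htime := sub_nonneg.2 (hs.t_pred_le hS.T_pos.le k₀)
  calc n * (‖S.ι‖ / κ * (L * (t k₀ - t (k₀ - 1))))
      ≤ S.stallBound κ L * (‖S.ι‖ / κ * (L * (t k₀ - t (k₀ - 1)))) := by
        gcongr
    _ = S.slopeBound κ L * (t k₀ - t (k₀ - 1)) := by rw [slopeBound]; ring

theorem norm_sub_le (hst : S.IsStall τ t z k₀ k₁) (hs : S.IsLocalMinScheme τ t z)
    (hS : S.ConvexAssumptions κ L ρ) (hτ : 0 < τ) (hk₀ : k₀ ≤ k) (hk : k ≤ k₁) :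
    ‖z k₁ - z k‖ ≤ S.slopeBound κ L * (t k₀ - t (k₀ - 1)) := by
  have hsteps := dist_le_Ico_sum_of_dist_le (f := z) hk (d := fun _ => ‖S.ι‖ / κ *
    (L * (t k₀ - t (k₀ - 1)))) fun {i} hki hi => by
      rw [dist_comm, dist_eq_norm]
      exact hst.norm_step_le hs hS hτ (hk₀.trans hki) hi
  rw [dist_comm, dist_eq_norm, Finset.sum_const, Nat.card_Ico, nsmul_eq_mul] at hsteps
  exact hsteps.trans (hst.length_mul_le hs hS hτ (Nat.sub_le_sub_left hk₀ k₁))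

theorem dissipation_step_le (hst : S.IsStall τ t z k₀ k₁) (hs : S.IsLocalMinScheme τ t z)
    (hS : S.ConvexAssumptions κ L ρ) (hτ : 0 < τ) {Λ : ℝ≥0}
    (hΛ : LipschitzOnWith Λ (S.dEnergy 0) (Metric.closedBall 0 (S.stateBound κ L ρ)))
    (hk₀ : k₀ ≤ k) (hk : k < k₁) :
    S.dEnergy (t k₀) (z k₁) (z (k + 1) - z k) + S.diss (z (k + 1) - z k) ≤
      Λ * (S.slopeBound κ L * (t k₀ - t (k₀ - 1))) *
        (‖S.ι‖ / κ * (L * (t k₀ - t (k₀ - 1)))) := by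
  have hmem := hs.t_mem hS.T_pos.le k₀
  have hstep := hs.dissipation_eq hS hτ k
  rw [hst.t_eq hk₀ hk] at hstep
  have hlip := (abs_le.1 (hS.abs_dEnergy_sub_apply_le hΛ hmem hmem (hs.norm_le hS hτ k₁)
    (hs.norm_le hS hτ (k + 1)) (z (k + 1) - z k))).2
  rw [sub_self, abs_zero, mul_zero, add_zero] at hlip
  have hbound : Λ * ‖z k₁ - z (k + 1)‖ * ‖z (k + 1) - z k‖ ≤
      Λ * (S.slopeBound κ L * (t k₀ - t (k₀ - 1))) *
        (‖S.ι‖ / κ * (L * (t k₀ - t (k₀ - 1)))) := by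
    have hdist := hst.norm_sub_le hs hS hτ (hk₀.trans k.le_succ) hk
    have hdist₀ := (norm_nonneg _).trans hdist
    gcongr
    exact hst.norm_step_le hs hS hτ hk₀ hk
  linarith [mul_nonneg (hs.multiplier_nonneg hS hτ (k + 1)) (norm_nonneg (S.ι (z (k + 1) - z k)))]

theorem dissipation_le (hst : S.IsStall τ t z k₀ k₁) (hs : S.IsLocalMinScheme τ t z)
    (hS : S.ConvexAssumptions κ L ρ) (hτ : 0 < τ) {Λ : ℝ≥0}
    (hΛ : LipschitzOnWith Λ (S.dEnergy 0) (Metric.closedBall 0 (S.stateBound κ L ρ))) :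
    S.dEnergy (t k₀) (z k₁) (z k₁ - z k₀) + S.diss (z k₁ - z k₀) ≤
      Λ * (S.slopeBound κ L * (t k₀ - t (k₀ - 1))) ^ 2 := by
  set h := t k₀ - t (k₀ - 1)
  have hpartial (k : ℕ) (hk₀ : k₀ ≤ k) : k ≤ k₁ →
      S.dEnergy (t k₀) (z k₁) (z k - z k₀) + S.diss (z k - z k₀) ≤
        (k - k₀ : ℕ) * (Λ * (S.slopeBound κ L * h) * (‖S.ι‖ / κ * (L * h))) := by
    induction k, hk₀ using Nat.le_induction with
    | base => simp [hS.diss_zero]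
    | succ k hk₀ ih =>
      intro hk
      have hstep := hst.dissipation_step_le hs hS hτ hΛ hk₀ hk
      have htriangle := hS.diss_add_le (z (k + 1) - z k) (z k - z k₀)
      rw [← sub_add_sub_cancel (z (k + 1)) (z k), map_add, Nat.succ_sub hk₀]
      push_cast
      linarith [ih (k.le_succ.trans hk)]
  have hdist := (norm_nonneg _).trans (hst.norm_sub_le hs hS hτ le_rfl hst.lt.le)
  calc S.dEnergy (t k₀) (z k₁) (z k₁ - z k₀) + S.diss (z k₁ - z k₀)
      ≤ (k₁ - k₀ : ℕ) * (Λ * (S.slopeBound κ L * h) * (‖S.ι‖ / κ * (L * h))) :=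
        hpartial k₁ hst.lt.le le_rfl
    _ = Λ * (S.slopeBound κ L * h) * ((k₁ - k₀ : ℕ) * (‖S.ι‖ / κ * (L * h))) := by ring
    _ ≤ Λ * (S.slopeBound κ L * h) * (S.slopeBound κ L * h) :=
        mul_le_mul_of_nonneg_left (hst.length_mul_le hs hS hτ le_rfl)
          (mul_nonneg Λ.coe_nonneg hdist)
    _ = Λ * (S.slopeBound κ L * h) ^ 2 := by ring

end IsStall

/-! ### Interpolants as approximate solutions -/

/-- Locally stable states `w i` at times `σ i` that satisfy the dissipation inequality in each time
step implicitly, up to an error `ε`; the discrete counterpart of `IsLipschitzApproxSolution`. -/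
structure IsDiscreteApproxSolution (S : RateIndependentSystem Z V X) (τ ε b K : ℝ) (m : ℕ)
    (σ : ℕ → ℝ) (w : ℕ → Z) : Prop where
  σ_zero : σ 0 = 0
  σ_last : σ m = S.T
  strictMonoOn : StrictMonoOn σ (Iic m)
  sub_le : ∀ i < m, σ (i + 1) - σ i ≤ τ
  initial : w 0 = S.z₀
  norm_le : ∀ i ≤ m, ‖w i‖ ≤ b
  norm_sub_le : ∀ i < m, ‖w (i + 1) - w i‖ ≤ K * (σ (i + 1) - σ i)
  stable : ∀ i ≤ m, S.AlmostStable 0 (σ i) (w i)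
  dissipation : ∀ i < m, S.dEnergy (σ (i + 1)) (w (i + 1)) (w (i + 1) - w i) +
    S.diss (w (i + 1) - w i) ≤ ε * (K * (σ (i + 1) - σ i))

namespace IsDiscreteApproxSolution

variable {τ ε b K : ℝ} {Λ : ℝ≥0} {m i : ℕ} {σ : ℕ → ℝ} {w : ℕ → Z} {y : ℝ → Z} {s t : ℝ}

theorem m_ne_zero (hw : S.IsDiscreteApproxSolution τ ε b K m σ w) (hT : 0 < S.T) : m ≠ 0 := by
  rintro rfl
  exact hT.ne (hw.σ_zero.symm.trans hw.σ_last)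

theorem mem_Icc_iff (hw : S.IsDiscreteApproxSolution τ ε b K m σ w) :
    t ∈ Icc 0 S.T ↔ t ∈ Icc (σ 0) (σ m) := by
  rw [hw.σ_zero, hw.σ_last]

theorem σ_mem (hw : S.IsDiscreteApproxSolution τ ε b K m σ w) (hi : i ≤ m) : σ i ∈ Icc 0 S.T :=
  hw.mem_Icc_iff.2 ⟨hw.strictMonoOn.monotoneOn (Nat.zero_le m) hi (Nat.zero_le i),
    hw.strictMonoOn.monotoneOn hi self_mem_Iic hi⟩

theorem σ_lt_succ (hw : S.IsDiscreteApproxSolution τ ε b K m σ w) (hi : i < m) :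
    σ i < σ (i + 1) :=
  hw.strictMonoOn hi.le hi i.lt_succ_self

theorem norm_interpolant_le (hw : S.IsDiscreteApproxSolution τ ε b K m σ w) (hT : 0 < S.T)
    (hy : IsAffineInterpolant m σ w y) (ht : t ∈ Icc 0 S.T) : ‖y t‖ ≤ b :=
  hy.norm_le (hw.m_ne_zero hT) hw.norm_le (hw.mem_Icc_iff.1 ht)

theorem norm_interpolant_sub_le (hw : S.IsDiscreteApproxSolution τ ε b K m σ w) (hT : 0 < S.T)
    (hy : IsAffineInterpolant m σ w y) (hs : s ∈ Icc 0 S.T) (ht : t ∈ Icc 0 S.T) (hst : s ≤ t) :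
    ‖y t - y s‖ ≤ K * (t - s) :=
  hy.norm_sub_le (hw.m_ne_zero hT) hw.strictMonoOn hw.norm_sub_le (hw.mem_Icc_iff.1 hs)
    (hw.mem_Icc_iff.1 ht) hst

theorem abs_dEnergy_sub_apply_le (hw : S.IsDiscreteApproxSolution τ ε b K m σ w)
    (hS : S.ConvexAssumptions κ L ρ)
    (hΛ : LipschitzOnWith Λ (S.dEnergy 0) (Metric.closedBall 0 b))
    (hy : IsAffineInterpolant m σ w y) (hs : s ∈ Icc 0 S.T) (hi : i < m) (hsi : s ≤ σ (i + 1))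
    (v : Z) :
    |S.dEnergy s (y s) v - S.dEnergy (σ (i + 1)) (w (i + 1)) v| ≤
      (Λ * K + L * ‖S.ι‖) * (σ (i + 1) - s) * ‖v‖ := by
  have hdist := hw.norm_interpolant_sub_le hS.T_pos hy hs (hw.σ_mem hi) hsi
  rw [hy.apply_node_succ hi (hw.σ_lt_succ hi)] at hdist
  refine (hS.abs_dEnergy_sub_apply_le hΛ hs (hw.σ_mem hi)
    (hw.norm_interpolant_le hS.T_pos hy hs) (hw.norm_le (i + 1) hi) v).trans ?_
  gcongr
  rw [norm_sub_rev, abs_sub_comm, abs_of_nonneg (sub_nonneg.2 hsi)]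
  calc Λ * ‖w (i + 1) - y s‖ + L * ‖S.ι‖ * (σ (i + 1) - s)
      ≤ Λ * (K * (σ (i + 1) - s)) + L * ‖S.ι‖ * (σ (i + 1) - s) := by gcongr
    _ = (Λ * K + L * ‖S.ι‖) * (σ (i + 1) - s) := by ring

theorem stable_interpolant (hw : S.IsDiscreteApproxSolution τ ε b K m σ w)
    (hS : S.ConvexAssumptions κ L ρ) (hK : 0 ≤ K)
    (hΛ : LipschitzOnWith Λ (S.dEnergy 0) (Metric.closedBall 0 b))
    (hy : IsAffineInterpolant m σ w y) (ht : t ∈ Icc 0 S.T) :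
    S.AlmostStable ((Λ * K + L * ‖S.ι‖) * τ) t (y t) := by
  intro v
  obtain ⟨i, hi, hti⟩ := exists_mem_Icc_succ (hw.m_ne_zero hS.T_pos) (hw.mem_Icc_iff.1 ht)
  have hshift := (abs_le.1 (hw.abs_dEnergy_sub_apply_le hS hΛ hy ht hi hti.2 v)).1
  have herr : (Λ * K + L * ‖S.ι‖) * (σ (i + 1) - t) * ‖v‖ ≤
      (Λ * K + L * ‖S.ι‖) * τ * ‖v‖ := by
    gcongr
    linarith [hti.1, hw.sub_le i hi]
  linarith [hw.stable (i + 1) hi v]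

theorem dissipation_piece (hw : S.IsDiscreteApproxSolution τ ε b K m σ w)
    (hS : S.ConvexAssumptions κ L ρ) (hK : 0 ≤ K)
    (hΛ : LipschitzOnWith Λ (S.dEnergy 0) (Metric.closedBall 0 b))
    (hy : IsAffineInterpolant m σ w y) {a : ℝ} (ha : a ∈ Icc 0 S.T) (hi : i < m)
    (hs : s ∈ Icc (σ i) (σ (i + 1))) (ht : t ∈ Icc (σ i) (σ (i + 1))) (has : a ≤ s)
    (hst : s ≤ t) :
    S.dEnergy a (y a) (y t - y s) + S.diss (y t - y s) ≤
      (ε + (Λ * K + L * ‖S.ι‖) * (τ + (t - a))) * (K * (t - s)) := by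
  set Q := Λ * K + L * ‖S.ι‖
  set d := w (i + 1) - w i
  set h := σ (i + 1) - σ i
  have hh : 0 < h := sub_pos.2 (hw.σ_lt_succ hi)
  have hshift := (abs_le.1 (hw.abs_dEnergy_sub_apply_le hS hΛ hy ha hi (has.trans hs.2) d)).2
  have herr : Q * (σ (i + 1) - a) * ‖d‖ ≤ Q * (τ + (t - a)) * (K * h) := by
    have hd : ‖d‖ ≤ K * h := hw.norm_sub_le i hi
    have htime : σ (i + 1) - a ≤ τ + (t - a) := by linarith [ht.1, hw.sub_le i hi]
    have hnonneg : 0 ≤ σ (i + 1) - a := sub_nonneg.2 (has.trans hs.2)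
    have hQ : 0 ≤ Q := by positivity
    exact mul_le_mul (mul_le_mul_of_nonneg_left htime hQ) hd (norm_nonneg d)
      (mul_nonneg hQ (hnonneg.trans htime))
  have hstep : S.dEnergy a (y a) d + S.diss d ≤ (ε + Q * (τ + (t - a))) * (K * h) := by
    linarith [hw.dissipation i hi]
  have hr : 0 ≤ (t - s) / h := div_nonneg (sub_nonneg.2 hst) hh.le
  rw [hy.sub_eq hi hs ht, map_smul, smul_eq_mul, hS.diss_smul hr, ← mul_add]
  refine (mul_le_mul_of_nonneg_left hstep hr).trans_eq ?_
  field_simp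

theorem dissipation_interpolant (hw : S.IsDiscreteApproxSolution τ ε b K m σ w)
    (hS : S.ConvexAssumptions κ L ρ) (hK : 0 ≤ K)
    (hΛ : LipschitzOnWith Λ (S.dEnergy 0) (Metric.closedBall 0 b))
    (hy : IsAffineInterpolant m σ w y) {a e : ℝ} (ha : a ∈ Icc 0 S.T) (he : e ∈ Icc 0 S.T)
    (hae : a ≤ e) :
    S.dEnergy a (y a) (y e - y a) + S.diss (y e - y a) ≤
      (ε + (Λ * K + L * ‖S.ι‖) * (τ + (e - a))) * (K * (e - a)) := by
  refine rel_of_rel_on_Icc_succ (r := fun s t => a ≤ s → t ≤ e →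
      S.dEnergy a (y a) (y t - y s) + S.diss (y t - y s) ≤
        (ε + (Λ * K + L * ‖S.ι‖) * (τ + (e - a))) * (K * (t - s)))
    (hw.m_ne_zero hS.T_pos) hw.strictMonoOn.monotoneOn (fun s u t hsu hut hdu hdt has hte => ?_)
    (fun i hi s hs t ht hst has hte => ?_) (hw.mem_Icc_iff.1 ha) (hw.mem_Icc_iff.1 he) hae le_rfl
    le_rfl
  · have htriangle := hS.diss_add_le (y t - y u) (y u - y s)
    rw [← sub_add_sub_cancel (y t) (y u), map_add]
    linarith [hdu has (hut.trans hte), hdt (has.trans hsu) hte]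
  · refine (hw.dissipation_piece hS hK hΛ hy ha hi hs ht has hst).trans ?_
    have := sub_nonneg.2 hst
    gcongr

theorem isLipschitzApproxSolution (hw : S.IsDiscreteApproxSolution τ ε b K m σ w)
    (hS : S.ConvexAssumptions κ L ρ) (hK : 0 ≤ K) (hε : 0 ≤ ε)
    (hΛ : LipschitzOnWith Λ (S.dEnergy 0) (Metric.closedBall 0 b))
    (hy : IsAffineInterpolant m σ w y) :
    S.IsLipschitzApproxSolution (ε + (Λ * K + L * ‖S.ι‖) * τ) b K (Λ * K + L * ‖S.ι‖) y := by
  have hm := hw.m_ne_zero hS.T_pos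
  have hσ := hw.σ_lt_succ (Nat.pos_of_ne_zero hm)
  refine ⟨?_, fun t => hw.norm_interpolant_le hS.T_pos hy,
    fun s hs t ht => hw.norm_interpolant_sub_le hS.T_pos hy hs ht, fun t ht v => ?_,
    fun s hs t ht hst => ?_⟩
  · rw [← hw.σ_zero, hy.apply_node (Nat.pos_of_ne_zero hm) hσ.le, hw.initial]
  · refine (hw.stable_interpolant hS hK hΛ hy ht v).trans ?_
    gcongr
    exact le_add_of_nonneg_left hε
  · refine (hw.dissipation_interpolant hS hK hΛ hy hs ht hst).trans_eq ?_
    ring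

end IsDiscreteApproxSolution

/-! ### The enumeration of the steps with progress in time -/

variable {τ : ℝ} {t : ℕ → ℝ} {z : ℕ → Z}

theorem progressIndex_zero : S.progressIndex t z 0 = 0 :=
  Nat.nth_zero_of_zero (p := (· ∈ S.progressIndices t z)) (Or.inr (Or.inl rfl))

theorem progressIndex_mem {i : ℕ} (hi : S.progressIndex t z i ≠ 0) :
    S.progressIndex t z i ∈ S.progressIndices t z :=
  Nat.nth_mem_of_ne_zero hi

theorem progressIndex_lt {i j : ℕ} (hij : i < j) (hj : S.progressIndex t z j ≠ 0) :
    S.progressIndex t z i < S.progressIndex t z j :=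
  Nat.nth_lt_nth' hij (Nat.lt_card_toFinset_of_nth_ne_zero hj)

theorem notMem_progressIndices {i k : ℕ} (hik : S.progressIndex t z i < k)
    (hki : k < S.progressIndex t z (i + 1)) : k ∉ S.progressIndices t z :=
  fun hk => hik.not_ge (Nat.le_nth_of_lt_nth_succ hki hk)

open Classical in
/-- The number of time intervals on which the interpolant is affine, `J - 1` in the notation of the
paper: the index in the enumeration `progressIndex` at which the final time is reached. -/
noncomputable def intervalCount (S : RateIndependentSystem Z V X) (t : ℕ → ℝ) (z : ℕ → Z) : ℕ :=
  Nat.count (· ∈ S.progressIndices t z) (S.endIndex t)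

namespace IsLocalMinScheme

theorem t_endIndex (hs : S.IsLocalMinScheme τ t z) (hS : S.ConvexAssumptions κ L ρ) (hτ : 0 < τ) :
    t (S.endIndex t) = S.T :=
  Nat.sInf_mem (s := {k | t k = S.T}) (hs.exists_t_eq hS hτ)

theorem t_eq_of_endIndex_le (hs : S.IsLocalMinScheme τ t z) (hS : S.ConvexAssumptions κ L ρ)
    (hτ : 0 < τ) {k : ℕ} (hk : S.endIndex t ≤ k) : t k = S.T :=
  le_antisymm (hs.t_mem hS.T_pos.le k).2
    ((hs.t_endIndex hS hτ).ge.trans (hs.t_monotone hS.T_pos.le hk))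

theorem endIndex_pos (hs : S.IsLocalMinScheme τ t z) (hS : S.ConvexAssumptions κ L ρ)
    (hτ : 0 < τ) : 0 < S.endIndex t := by
  refine Nat.pos_of_ne_zero fun hzero => hS.T_pos.ne ?_
  rw [← hs.t_endIndex hS hτ, hzero, hs.t_zero]

theorem t_pred_lt_t_endIndex (hs : S.IsLocalMinScheme τ t z) (hS : S.ConvexAssumptions κ L ρ)
    (hτ : 0 < τ) : t (S.endIndex t - 1) < t (S.endIndex t) := by
  rw [hs.t_endIndex hS hτ]
  exact lt_of_le_of_ne (hs.t_mem hS.T_pos.le _).2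
    (Nat.notMem_of_lt_sInf (s := {k | t k = S.T}) (Nat.sub_one_lt (hs.endIndex_pos hS hτ).ne'))

theorem active_of_not_lt (hs : S.IsLocalMinScheme τ t z) (hS : S.ConvexAssumptions κ L ρ)
    (hτ : 0 < τ) {k : ℕ} (hk : ¬ t k < t (k + 1))
    (hunstable : S.endIndex t < k + 1 → ¬ S.LocallyStable S.T (z (k + 1))) :
    ‖S.ι (z (k + 1) - z k)‖ = τ ∧ t (k + 1) = t k := by
  have ht : t (k + 1) = t k :=
    le_antisymm (not_lt.1 hk) (hs.t_monotone hS.T_pos.le k.le_succ)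
  refine ⟨(hs.feasible k).antisymm (not_lt.1 fun hlt => ?_), ht⟩
  have htk : t k = S.T := by
    have hsucc := hs.t_succ k
    rcases min_choice (t k + τ - ‖S.ι (z (k + 1) - z k)‖) S.T with hmin | hmin <;>
      rw [hmin] at hsucc <;> linarith
  have hstable := hs.stable_succ_up_to_multiplier hS hτ k
  simp only [hs.multiplier_eq_zero hS hτ hlt, htk] at hstable
  exact hunstable (Nat.lt_succ_of_le (Nat.sInf_le htk)) (hS.locallyStable_iff.2 fun w => by
    simpa only [zero_mul] using hstable w)

theorem exists_stable (hs : S.IsLocalMinScheme τ t z) (hS : S.ConvexAssumptions κ L ρ)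
    (hτ : 0 < τ) : ∃ k, S.endIndex t < k ∧ S.LocallyStable S.T (z k) := by
  by_contra! hunstable
  have hstall : S.IsStall τ t z (S.endIndex t) (S.endIndex t + S.stallBound κ L + 1) :=
    ⟨by lia, hs.multiplier_eq_zero_of_t_lt hS hτ (hs.t_pred_lt_t_endIndex hS hτ), fun k hk _ =>
      hs.active_of_not_lt hS hτ
        (((hs.t_mem hS.T_pos.le (k + 1)).2.trans_eq (hs.t_eq_of_endIndex_le hS hτ hk).symm).not_gt)
        (hunstable (k + 1))⟩
  have := hstall.length_le hs hS hτ
  lia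

theorem stableEndIndex_mem (hs : S.IsLocalMinScheme τ t z) (hS : S.ConvexAssumptions κ L ρ)
    (hτ : 0 < τ) :
    S.endIndex t < S.stableEndIndex t z ∧ S.LocallyStable S.T (z (S.stableEndIndex t z)) :=
  Nat.sInf_mem (s := {k | S.endIndex t < k ∧ S.LocallyStable S.T (z k)})
    (hs.exists_stable hS hτ)

theorem le_stableEndIndex (hs : S.IsLocalMinScheme τ t z) (hS : S.ConvexAssumptions κ L ρ)
    (hτ : 0 < τ) {k : ℕ} (hk : k ∈ S.progressIndices t z) : k ≤ S.stableEndIndex t z := by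
  rcases hk with ⟨⟨-, hk⟩, -⟩ | rfl | rfl
  exacts [hk.trans (hs.stableEndIndex_mem hS hτ).1.le, Nat.zero_le _, le_rfl]

theorem t_pred_lt_of_mem_progressIndices {k : ℕ} (hk : k ∈ S.progressIndices t z) (hzero : k ≠ 0)
    (hlt : k < S.stableEndIndex t z) : t (k - 1) < t k := by
  rcases hk with ⟨-, hk⟩ | hk | hk
  exacts [sub_pos.1 hk, absurd hk hzero, absurd hk hlt.ne]

theorem isStall_progressIndex (hs : S.IsLocalMinScheme τ t z) (hS : S.ConvexAssumptions κ L ρ)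
    (hτ : 0 < τ) {i : ℕ} (hi : S.progressIndex t z (i + 1) ≠ 0) :
    S.IsStall τ t z (S.progressIndex t z i) (S.progressIndex t z (i + 1)) := by
  have hlt := progressIndex_lt i.lt_succ_self hi
  have hle := hs.le_stableEndIndex hS hτ (progressIndex_mem hi)
  refine ⟨hlt, ?_, fun k hik hki => ?_⟩
  · rcases eq_or_ne (S.progressIndex t z i) 0 with hzero | hne
    · rw [hzero, multiplier]
    · exact hs.multiplier_eq_zero_of_t_lt hS hτ
        (t_pred_lt_of_mem_progressIndices (progressIndex_mem hne) hne (hlt.trans_le hle))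
  · have hk := notMem_progressIndices (Nat.lt_succ_of_le hik) hki
    refine hs.active_of_not_lt hS hτ (fun hprogress => ?_) fun hend hstable =>
      Nat.notMem_of_lt_sInf (hki.trans_le hle) ⟨hend, hstable⟩
    rcases le_or_gt (k + 1) (S.endIndex t) with hend | hend
    · exact hk (Or.inl ⟨⟨k.succ_pos, hend⟩, sub_pos.2 hprogress⟩)
    · exact hprogress.not_ge ((hs.t_mem hS.T_pos.le (k + 1)).2.trans_eq
        (hs.t_eq_of_endIndex_le hS hτ (Nat.le_of_lt_succ hend)).symm)

theorem progressIndex_succ_le (hs : S.IsLocalMinScheme τ t z) (hS : S.ConvexAssumptions κ L ρ)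
    (hτ : 0 < τ) (i : ℕ) :
    S.progressIndex t z (i + 1) ≤ S.progressIndex t z i + S.stallBound κ L := by
  rcases eq_or_ne (S.progressIndex t z (i + 1)) 0 with hzero | hne
  · exact hzero.trans_le (Nat.zero_le _)
  · exact (hs.isStall_progressIndex hS hτ hne).length_le hs hS hτ

theorem endIndex_mem_progressIndices (hs : S.IsLocalMinScheme τ t z)
    (hS : S.ConvexAssumptions κ L ρ) (hτ : 0 < τ) : S.endIndex t ∈ S.progressIndices t z :=
  Or.inl ⟨⟨hs.endIndex_pos hS hτ, le_rfl⟩, sub_pos.2 (hs.t_pred_lt_t_endIndex hS hτ)⟩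

theorem progressIndex_intervalCount (hs : S.IsLocalMinScheme τ t z)
    (hS : S.ConvexAssumptions κ L ρ) (hτ : 0 < τ) :
    S.progressIndex t z (S.intervalCount t z) = S.endIndex t := by
  classical exact Nat.nth_count (hs.endIndex_mem_progressIndices hS hτ)

theorem progressIndex_intervalCount_succ (hs : S.IsLocalMinScheme τ t z)
    (hS : S.ConvexAssumptions κ L ρ) (hτ : 0 < τ) :
    S.progressIndex t z (S.intervalCount t z + 1) = S.stableEndIndex t z := by
  classical
  have hlast : {k | k ∈ S.progressIndices t z ∧ S.endIndex t + 1 ≤ k} =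
      {S.stableEndIndex t z} := by
    ext k
    refine ⟨?_, ?_⟩
    · rintro ⟨⟨⟨-, hk⟩, -⟩ | rfl | rfl, hlt⟩
      exacts [absurd hlt hk.not_gt, absurd hlt (Nat.not_succ_le_zero _), rfl]
    · rintro rfl
      exact ⟨Or.inr (Or.inr rfl), (hs.stableEndIndex_mem hS hτ).1⟩
  have hcount : S.intervalCount t z + 1 =
      Nat.count (· ∈ S.progressIndices t z) (S.endIndex t + 1) :=
    (Nat.count_succ_eq_succ_count_iff.2 (hs.endIndex_mem_progressIndices hS hτ)).symm
  rw [hcount, progressIndex, Nat.nth_count_eq_sInf, hlast, csInf_singleton]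

theorem strictMonoOn_progressIndex (hs : S.IsLocalMinScheme τ t z)
    (hS : S.ConvexAssumptions κ L ρ) (hτ : 0 < τ) :
    StrictMonoOn (S.progressIndex t z) (Iic (S.intervalCount t z + 1)) := by
  have hlast : S.progressIndex t z (S.intervalCount t z + 1) ≠ 0 := by
    rw [hs.progressIndex_intervalCount_succ hS hτ]
    exact (hs.stableEndIndex_mem hS hτ).1.ne_bot
  exact fun i _ j hj hij => Nat.nth_lt_nth' hij fun hf =>
    hj.trans_lt (Nat.lt_card_toFinset_of_nth_ne_zero hlast hf)

theorem progressIndex_ne_zero (hs : S.IsLocalMinScheme τ t z) (hS : S.ConvexAssumptions κ L ρ)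
    (hτ : 0 < τ) {i : ℕ} (hi : i ≠ 0) (hle : i ≤ S.intervalCount t z + 1) :
    S.progressIndex t z i ≠ 0 := by
  have := hs.strictMonoOn_progressIndex hS hτ (Nat.zero_le _) hle (Nat.pos_of_ne_zero hi)
  rw [progressIndex_zero] at this
  exact this.ne'

theorem strictMonoOn_t_progressIndex (hs : S.IsLocalMinScheme τ t z)
    (hS : S.ConvexAssumptions κ L ρ) (hτ : 0 < τ) :
    StrictMonoOn (fun i => t (S.progressIndex t z i)) (Iic (S.intervalCount t z)) := by
  intro i _ j hj hij
  have hj' : j < S.intervalCount t z + 1 := Nat.lt_succ_of_le hj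
  have hne := hs.progressIndex_ne_zero hS hτ (Nat.ne_zero_of_lt hij) hj'.le
  have hlt := hs.strictMonoOn_progressIndex hS hτ hj'.le self_mem_Iic hj'
  rw [hs.progressIndex_intervalCount_succ hS hτ] at hlt
  exact (hs.t_monotone hS.T_pos.le (Nat.le_sub_one_of_lt (progressIndex_lt hij hne))).trans_lt
    (t_pred_lt_of_mem_progressIndices (progressIndex_mem hne) hne hlt)

theorem isStall_of_le_intervalCount (hs : S.IsLocalMinScheme τ t z)
    (hS : S.ConvexAssumptions κ L ρ) (hτ : 0 < τ) {i : ℕ} (hi : i ≤ S.intervalCount t z) :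
    S.IsStall τ t z (S.progressIndex t z i) (S.progressIndex t z (i + 1)) :=
  hs.isStall_progressIndex hS hτ
    (hs.progressIndex_ne_zero hS hτ i.succ_ne_zero (Nat.succ_le_succ hi))

theorem t_progressIndex_succ_pred (hs : S.IsLocalMinScheme τ t z)
    (hS : S.ConvexAssumptions κ L ρ) (hτ : 0 < τ) {i : ℕ} (hi : i ≤ S.intervalCount t z) :
    t (S.progressIndex t z (i + 1) - 1) = t (S.progressIndex t z i) := by
  have hstall := hs.isStall_of_le_intervalCount hS hτ hi
  exact hstall.t_eq (Nat.le_sub_one_of_lt hstall.lt) (Nat.sub_one_lt (Nat.ne_zero_of_lt hstall.lt))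

theorem intervalIndex_eq (hs : S.IsLocalMinScheme τ t z) (hS : S.ConvexAssumptions κ L ρ)
    (hτ : 0 < τ) {i : ℕ} (hi : i < S.intervalCount t z) {s : ℝ}
    (hsi : s ∈ Ico (t (S.progressIndex t z i)) (t (S.progressIndex t z (i + 1)))) :
    S.intervalIndex t z s = i + 1 := by
  refine IsLeast.csInf_eq ⟨hsi.2, fun j hj => Nat.succ_le_of_lt (not_le.1 fun hji => ?_)⟩
  have hmono := (hs.strictMonoOn_t_progressIndex hS hτ).monotoneOn (hji.trans hi.le) hi.le hji
  exact hsi.1.not_gt (lt_of_lt_of_le hj hmono)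

theorem interpolant_eq (hs : S.IsLocalMinScheme τ t z) (hS : S.ConvexAssumptions κ L ρ)
    (hτ : 0 < τ) {i : ℕ} (hi : i < S.intervalCount t z) {s : ℝ}
    (hsi : s ∈ Ico (t (S.progressIndex t z i)) (t (S.progressIndex t z (i + 1)))) :
    S.interpolant t z s = z (S.progressIndex t z (i + 1)) +
      ((s - t (S.progressIndex t z i)) /
        (t (S.progressIndex t z (i + 1)) - t (S.progressIndex t z i))) •
          (z (S.progressIndex t z (i + 2)) - z (S.progressIndex t z (i + 1))) := by
  have hsT : s < S.T := hsi.2.trans_le (hs.t_mem hS.T_pos.le _).2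
  simp only [interpolant, hs.intervalIndex_eq hS hτ hi hsi, if_pos hsT, Nat.add_sub_cancel]

theorem interpolant_node_succ (hs : S.IsLocalMinScheme τ t z) (hS : S.ConvexAssumptions κ L ρ)
    (hτ : 0 < τ) {i : ℕ} (hi : i < S.intervalCount t z) :
    S.interpolant t z (t (S.progressIndex t z (i + 1))) = z (S.progressIndex t z (i + 2)) := by
  rcases (Nat.succ_le_of_lt hi).lt_or_eq with hlt | heq
  · rw [hs.interpolant_eq hS hτ hlt ⟨le_rfl, hs.strictMonoOn_t_progressIndex hS hτ hlt.le hlt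
      (Nat.lt_succ_self _)⟩, sub_self, zero_div, zero_smul, add_zero]
  · rw [show i + 1 = S.intervalCount t z from heq, show i + 2 = S.intervalCount t z + 1 by lia,
      hs.progressIndex_intervalCount hS hτ, hs.progressIndex_intervalCount_succ hS hτ,
      hs.t_endIndex hS hτ, interpolant, if_neg (lt_irrefl S.T)]

theorem isAffineInterpolant (hs : S.IsLocalMinScheme τ t z) (hS : S.ConvexAssumptions κ L ρ)
    (hτ : 0 < τ) :
    IsAffineInterpolant (S.intervalCount t z) (fun i => t (S.progressIndex t z i))
      (fun i => z (S.progressIndex t z (i + 1))) (S.interpolant t z) := by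
  intro i hi s hsi
  rcases hsi.2.lt_or_eq with hlt | rfl
  · exact hs.interpolant_eq hS hτ hi ⟨hsi.1, hlt⟩
  · have hpiece := sub_pos.2 (hs.strictMonoOn_t_progressIndex hS hτ hi.le hi i.lt_succ_self)
    rw [hs.interpolant_node_succ hS hτ hi, div_self hpiece.ne', one_smul, add_sub_cancel]

theorem almostStable_progressIndex_succ (hs : S.IsLocalMinScheme τ t z)
    (hS : S.ConvexAssumptions κ L ρ) (hτ : 0 < τ) {i : ℕ} (hi : i ≤ S.intervalCount t z) :
    S.AlmostStable 0 (t (S.progressIndex t z i)) (z (S.progressIndex t z (i + 1))) := by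
  rcases hi.lt_or_eq with hlt | rfl
  · intro w
    have hstall := hs.isStall_of_le_intervalCount hS hτ (Nat.succ_le_of_lt hlt)
    have hstable := hs.stable_succ_up_to_multiplier hS hτ (S.progressIndex t z (i + 1) - 1) w
    rw [Nat.sub_add_cancel (Nat.pos_of_ne_zero (hs.progressIndex_ne_zero hS hτ i.succ_ne_zero
      (Nat.succ_le_succ hi))), hstall.multiplier_eq_zero, zero_mul,
      hs.t_progressIndex_succ_pred hS hτ hi] at hstable
    rwa [zero_mul]
  · rw [hs.progressIndex_intervalCount hS hτ, hs.progressIndex_intervalCount_succ hS hτ,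
      hs.t_endIndex hS hτ, ← hS.locallyStable_iff]
    exact (hs.stableEndIndex_mem hS hτ).2

theorem isDiscreteApproxSolution (hs : S.IsLocalMinScheme τ t z) (hS : S.ConvexAssumptions κ L ρ)
    (hτ : 0 < τ) {Λ : ℝ≥0}
    (hΛ : LipschitzOnWith Λ (S.dEnergy 0) (Metric.closedBall 0 (S.stateBound κ L ρ))) :
    S.IsDiscreteApproxSolution τ (Λ * S.slopeBound κ L * τ) (S.stateBound κ L ρ)
      (S.slopeBound κ L) (S.intervalCount t z) (fun i => t (S.progressIndex t z i))
      (fun i => z (S.progressIndex t z (i + 1))) := by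
  have hK := hS.slopeBound_nonneg
  have hmono := hs.strictMonoOn_t_progressIndex hS hτ
  have hpred {i : ℕ} (hi : i < S.intervalCount t z) :=
    hs.t_progressIndex_succ_pred hS hτ hi.le
  have hstall {i : ℕ} (hi : i ≤ S.intervalCount t z) := hs.isStall_of_le_intervalCount hS hτ hi
  have hsub {i : ℕ} (hi : i < S.intervalCount t z) :
      t (S.progressIndex t z (i + 1)) - t (S.progressIndex t z i) ≤ τ := by
    rw [← hpred hi]
    exact hs.t_sub_pred_le hτ.le _
  refine ⟨?_, ?_, hmono, fun i hi => hsub hi, ?_, fun i _ => hs.norm_le hS hτ _, fun i hi => ?_,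
    fun i hi => hs.almostStable_progressIndex_succ hS hτ hi, fun i hi => ?_⟩
  · rw [progressIndex_zero, hs.t_zero]
  · rw [hs.progressIndex_intervalCount hS hτ, hs.t_endIndex hS hτ]
  · have hnorm := (hstall (Nat.zero_le _)).norm_sub_le hs hS hτ le_rfl
      (hstall (Nat.zero_le _)).lt.le
    rw [progressIndex_zero, Nat.zero_sub, sub_self, mul_zero, hs.z_zero] at hnorm
    exact sub_eq_zero.1 (norm_le_zero_iff.1 hnorm)
  · have hnorm := (hstall hi).norm_sub_le hs hS hτ le_rfl (hstall hi).lt.le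
    rwa [hpred hi] at hnorm
  · have hdiss := (hstall hi).dissipation_le hs hS hτ hΛ
    rw [hpred hi] at hdiss
    refine hdiss.trans ?_
    have hh := sub_nonneg.2 (hmono hi.le hi i.lt_succ_self).le
    calc Λ * (S.slopeBound κ L * (t (S.progressIndex t z (i + 1)) - t (S.progressIndex t z i))) ^ 2
        = Λ * S.slopeBound κ L * (t (S.progressIndex t z (i + 1)) - t (S.progressIndex t z i)) *
          (S.slopeBound κ L *
            (t (S.progressIndex t z (i + 1)) - t (S.progressIndex t z i))) := by ring
      _ ≤ _ := by gcongr; exact hsub hi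

theorem isLipschitzApproxSolution_interpolant (hs : S.IsLocalMinScheme τ t z)
    (hS : S.ConvexAssumptions κ L ρ) (hτ : 0 < τ) {Λ : ℝ≥0}
    (hΛ : LipschitzOnWith Λ (S.dEnergy 0) (Metric.closedBall 0 (S.stateBound κ L ρ))) :
    S.IsLipschitzApproxSolution
      (Λ * S.slopeBound κ L * τ + (Λ * S.slopeBound κ L + L * ‖S.ι‖) * τ) (S.stateBound κ L ρ)
      (S.slopeBound κ L) (Λ * S.slopeBound κ L + L * ‖S.ι‖) (S.interpolant t z) := by
  have hK := hS.slopeBound_nonneg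
  exact (hs.isDiscreteApproxSolution hS hτ hΛ).isLipschitzApproxSolution hS hK (by positivity) hΛ
    (hs.isAffineInterpolant hS hτ)

end IsLocalMinScheme

namespace ConvexAssumptions

theorem exists_isLipschitzApproxSolution_interpolant (hS : S.ConvexAssumptions κ L ρ) :
    ∃ D Q : ℝ, 0 ≤ D ∧ 0 ≤ Q ∧ ∀ (τ : ℝ) (t : ℕ → ℝ) (z : ℕ → Z), 0 < τ →
      S.IsLocalMinScheme τ t z → S.IsLipschitzApproxSolution (D * τ) (S.stateBound κ L ρ)
        (S.slopeBound κ L) Q (S.interpolant t z) := by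
  have hK := hS.slopeBound_nonneg
  obtain ⟨Λ, hΛ⟩ := hS.exists_dEnergy_lipschitzOnWith (S.stateBound κ L ρ)
  refine ⟨Λ * S.slopeBound κ L + (Λ * S.slopeBound κ L + L * ‖S.ι‖),
    Λ * S.slopeBound κ L + L * ‖S.ι‖, by positivity, by positivity, fun τ t z hτ hs => ?_⟩
  rw [add_mul]
  exact hs.isLipschitzApproxSolution_interpolant hS hτ hΛ

theorem exists_isApproxSolution_zero [CompleteSpace Z] (hS : S.ConvexAssumptions κ L ρ) :
    ∃ z : ℝ → Z, S.IsApproxSolution 0 (S.stateBound κ L ρ) (fun t => S.slopeBound κ L * t) z := by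
  obtain ⟨D, Q, hD, hQ, happrox⟩ := hS.exists_isLipschitzApproxSolution_interpolant
  have hτ (n : ℕ) : (0 : ℝ) < 1 / (n + 1) := Nat.one_div_pos_of_nat
  choose t x hscheme using fun n => hS.exists_isLocalMinScheme (hτ n).le
  have hlim : Filter.Tendsto (fun n : ℕ => D * (1 / ((n : ℝ) + 1))) Filter.atTop (nhds 0) := by
    simpa only [mul_zero] using (tendsto_one_div_add_atTop_nhds_zero_nat (𝕜 := ℝ)).const_mul D
  obtain ⟨z, hz⟩ := hS.exists_isLipschitzApproxSolution_zero hS.stateBound_nonneg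
    hS.slopeBound_nonneg hQ (fun n => mul_nonneg hD (hτ n).le) hlim
    fun n => happrox _ _ _ (hτ n) (hscheme n)
  exact ⟨z, hz.isApproxSolution hS.slopeBound_nonneg hQ⟩

theorem eqOn_of_isDifferentialSolution [CompleteSpace Z] (hS : S.ConvexAssumptions κ L ρ) {K : ℝ}
    {z y : ℝ → Z} (hz : S.IsApproxSolution 0 (S.stateBound κ L ρ) (fun t => K * t) z)
    (hy : S.IsDifferentialSolution y) : EqOn y z (Icc 0 S.T) := by
  intro s hs
  obtain ⟨G, hG⟩ := hS.exists_isApproxSolution hy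
  obtain ⟨C, hcomparison⟩ := hS.exists_sq_norm_sub_le hS.stateBound_nonneg (hz.lipschitz_nonneg hS)
  have hdist := hcomparison 0 0 G y z le_rfl le_rfl hG hz s hs
  rw [add_zero, zero_mul, mul_zero] at hdist
  exact sub_eq_zero.1 (norm_eq_zero.1 ((sq_nonpos_iff _).1 hdist))

theorem exists_error_bound (hS : S.ConvexAssumptions κ L ρ) {z : ℝ → Z}
    (hz : S.IsApproxSolution 0 (S.stateBound κ L ρ) (fun t => S.slopeBound κ L * t) z) :
    ∃ C, 0 < C ∧ ∀ (τ : ℝ) (t : ℕ → ℝ) (x : ℕ → Z), 0 < τ → S.IsLocalMinScheme τ t x →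
      ∀ s ∈ Icc 0 S.T, ‖z s - S.interpolant t x s‖ ≤ C * √τ := by
  set K := S.slopeBound κ L
  have hK : 0 ≤ K := hS.slopeBound_nonneg
  obtain ⟨D, Q, hD, hQ, happrox⟩ := hS.exists_isLipschitzApproxSolution_interpolant
  obtain ⟨C, hcomparison⟩ := hS.exists_sq_norm_sub_le hS.stateBound_nonneg hK
  refine ⟨√(C * (D * (K * S.T + K * S.T))) + 1, by positivity, fun τ t x hτ hs s hsT => ?_⟩
  have hdist := hcomparison 0 (D * τ) _ z _ le_rfl (mul_nonneg hD hτ.le) hz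
    ((happrox τ t x hτ hs).isApproxSolution hK hQ) s hsT
  calc ‖z s - S.interpolant t x s‖
      ≤ √(C * (D * (K * S.T + K * S.T)) * τ) := Real.le_sqrt_of_sq_le (hdist.trans_eq (by ring))
    _ = √(C * (D * (K * S.T + K * S.T))) * √τ := Real.sqrt_mul' _ hτ.le
    _ ≤ (√(C * (D * (K * S.T + K * S.T))) + 1) * √τ := by
        gcongr
        exact le_add_of_nonneg_right one_pos.le

end ConvexAssumptions

end RateIndependentSystem

theorem theorem3p15_general {Z V X : Type*}
    [NormedAddCommGroup Z] [InnerProductSpace ℝ Z] [CompleteSpace Z]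
    [NormedAddCommGroup V] [InnerProductSpace ℝ V]
    [NormedAddCommGroup X] [NormedSpace ℝ X]
    (S : RateIndependentSystem Z V X) {κ : ℝ} {L ρ : ℝ≥0} (hS : S.ConvexAssumptions κ L ρ) :
    (∀ τ : ℝ, 0 < τ → ∃ (t : ℕ → ℝ) (z : ℕ → Z), S.IsLocalMinScheme τ t z) ∧
    ∃ zsol : ℝ → Z, S.IsDifferentialSolution zsol ∧
      (∃ K : ℝ≥0, LipschitzOnWith K zsol (Icc 0 S.T)) ∧
      (∀ y : ℝ → Z, S.IsDifferentialSolution y → EqOn y zsol (Icc 0 S.T)) ∧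
      ∃ C : ℝ, 0 < C ∧ ∃ M : ℕ,
        ∀ (τ : ℝ) (t : ℕ → ℝ) (z : ℕ → Z), 0 < τ → S.IsLocalMinScheme τ t z →
          (∃ k, t k = S.T) ∧
          (∃ k, S.endIndex t < k ∧ S.LocallyStable S.T (z k)) ∧
          (∀ i, S.progressIndex t z (i + 1) ≤ S.progressIndex t z i + M) ∧
          ∀ s ∈ Icc 0 S.T, ‖zsol s - S.interpolant t z s‖ ≤ C * √τ := by
  obtain ⟨zsol, hz⟩ := hS.exists_isApproxSolution_zero
  obtain ⟨C, hC, herror⟩ := hS.exists_error_bound hz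
  have hlip : LipschitzOnWith ⟨S.slopeBound κ L, hS.slopeBound_nonneg⟩ zsol (Icc 0 S.T) :=
    lipschitzOnWith_Icc_of_norm_sub_le fun s hs t ht hst =>
      (hz.norm_sub_le s hs t ht hst).trans_eq (mul_sub _ t s).symm
  exact ⟨fun τ hτ => hS.exists_isLocalMinScheme hτ.le, zsol, hz.isDifferentialSolution hS,
    ⟨_, hlip⟩, fun y hy => hS.eqOn_of_isDifferentialSolution hz hy, C, hC, S.stallBound κ L,
    fun τ t z hτ hs => ⟨hs.exists_t_eq hS hτ, hs.exists_stable hS hτ,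
      hs.progressIndex_succ_le hS hτ, herror τ t z hτ hs⟩⟩

theorem theorem3p15 {Z V X : Type*}
    [NormedAddCommGroup Z] [InnerProductSpace ℝ Z] [CompleteSpace Z]
    [NormedAddCommGroup V] [InnerProductSpace ℝ V] [CompleteSpace V]
    [NormedAddCommGroup X] [NormedSpace ℝ X] [CompleteSpace X]
    (S : RateIndependentSystem Z V X) (hS : S.Assumptions) (hconv : S.UniformlyConvex) :
    -- the scheme is well defined for every step size
    (∀ τ : ℝ, 0 < τ → ∃ (t : ℕ → ℝ) (z : ℕ → Z), S.IsLocalMinScheme τ t z) ∧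
    -- there is a unique differential solution, and it is Lipschitz continuous
    ∃ zsol : ℝ → Z, S.IsDifferentialSolution zsol ∧
      (∃ K : ℝ≥0, LipschitzOnWith K zsol (Icc 0 S.T)) ∧
      (∀ y : ℝ → Z, S.IsDifferentialSolution y → EqOn y zsol (Icc 0 S.T)) ∧
      -- constants that do not depend on the step size
      ∃ C : ℝ, 0 < C ∧ ∃ M : ℕ,
        ∀ (τ : ℝ) (t : ℕ → ℝ) (z : ℕ → Z), 0 < τ → S.IsLocalMinScheme τ t z →
          -- the final time and then a locally stable state are reached
          (∃ k, t k = S.T) ∧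
          (∃ k, S.endIndex t < k ∧ S.LocallyStable S.T (z k)) ∧
          -- stalls last a bounded number of steps
          (∀ i, S.progressIndex t z (i + 1) ≤ S.progressIndex t z i + M) ∧
          -- the error estimate
          ∀ s ∈ Icc 0 S.T, ‖zsol s - S.interpolant t z s‖ ≤ C * √τ := by
  obtain ⟨κ, L, ρ, hS'⟩ := hS.exists_convexAssumptions hconv
  exact theorem3p15_general S hS'
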